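/- Let $K,L,I,J$ be non-empty finite sets and $G^{k\ell}\in\mathbb R^{I\times J}$ for $(k,\ell)\in K\times L$. For $\pi\in\Delta(K\times L)$, $\zeta\in\mathbb R^K$ and $\theta\in\Delta(\mathbb N^*)$, the repeated game $\mathcal G_\theta(\pi;\zeta)$ is played as follows: $(k,\ell)$ is drawn from $\pi$, player 1 learns $k$ and player 2 learns $\ell$; at each stage $m\ge 1$ they choose simultaneously $i_m\in I$, $j_m\in J$, which are then observed by both. A (behavioural) strategy of player 1 is a map $\hat s$ from $K\times\bigcup_{m\ge1}(I\times J)^{m-1}$ to $\Delta(I)$, one of player 2 is a map $\hat t$ from $L\times\bigcup_{m\ge1}(I\times J)^{m-1}$ to $\Delta(J)$, and the payoff, maximized by player 1 and minimized by player 2, is $$\gamma_\theta(\pi,\hat s,\hat t;\zeta)=\mathbb E^\pi_{\hat s,\hat t}\Big[\sum_{m\ge1}\theta_m\,\zeta^kG^{k\ell}(i_m,j_m)\Big].$$ Put $\mathcal G_\theta(\pi)=\mathcal G_\theta(\pi;\mathbf 1)$. For $p\in\Delta(K)$ and $Q\in\Delta(L)^K$ let $(p\otimes Q)^{k\ell}=p^kQ(\ell|k)$.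 For $x\in\mathbb R^K$ the auxiliary dual game $\mathcal D[\mathcal G_\theta](x,Q;\zeta)$ is the one in which player 1 chooses $p\in\Delta(K)$ and $\hat s$, player 2 chooses $\hat t$, and the payoff is $\gamma_\theta(p\otimes Q,\hat s,\hat t;\zeta)-\langle p,x\rangle$. For $\tau\in\Delta(J)^L$ put $\mathbb P(j|k)=\sum_\ell Q(\ell|k)\tau^\ell(j)$, $\zeta_j^k=\zeta^k\,\mathbb P(j|k)$, $Q_j(\ell|k)=Q(\ell|k)\tau^\ell(j)/\mathbb P(j|k)$ (with $Q_j(\cdot|k)=Q(\cdot|k)$ when $\mathbb P(j|k)=0$), and let $$G^{k,Q,\zeta}_{i\tau}=\zeta^k\sum_{\ell,j}Q(\ell|k)\,\tau^\ell(j)\,G^{k\ell}(i,j)$$ be the expected first-stage payoff given $k$ and $i$. If $\theta_1<1$, let $\theta^+_m=\theta_{m+1}/(1-\theta_1)$. **Theorem (Dual recursive formula and Markovian optimal strategies).** 1. For all $\pi,x,Q,\zeta,\theta$ the games $\mathcal G_\theta(\pi;\zeta)$ and $\mathcal D[\mathcal G_\theta](x,Q;\zeta)$ have values (maxmin equals minmax).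 The values of $\mathcal G_\theta(\pi)$ and of $\mathcal D[\mathcal G_\theta](x,Q;\zeta)$ are denoted $v_\theta(\pi)$ and $w_\theta(x,Q;\zeta)$. 2. For all $x,Q,\zeta$ and all $\theta$ with $\theta_1<1$, $$w_\theta(x,Q;\zeta)=(1-\theta_1)\min_{\tau\in\Delta(J)^L}\ \min_{\substack{(x_{ij})\in(\mathbb R^K)^{I\times J}\\ \forall i,\ \sum_jx_{ij}=\frac{x-\theta_1G^{Q,\zeta}_{i\tau}}{1-\theta_1}}}\ \max_{i\in I}\sum_{j\in J}w_{\theta^+}(x_{ij},Q_j;\zeta_j),\qquad(\ast)$$ and both minima are attained. If $\theta_1=1$, then $w_\theta(x,Q;\zeta)=\min_{\tau\in\Delta(J)^L}\max_{i\in I,\,k\in K}\big(G^{k,Q,\zeta}_{i\tau}-x^k\big)$ $(\ast\ast)$, the minimum being attained. 3. Call policy a map that assigns to each state $(x,Q,\zeta,\theta)$ some $\tau\in\Delta(J)^L$ and $(x_{ij})\in(\mathbb R^K)^{I\times J}$, and call it optimal if at every state with $\theta\in\Delta(\mathbb N^*)$ its choice is a minimizer in $(\ast)$ when $\theta_1<1$,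 and its $\tau$ is a minimizer in $(\ast\ast)$ when $\theta_1=1$. A policy and an initial state define a Markovian strategy of player 2: at each stage play $\tau^\ell$, where $\tau$ is the policy's choice at the current state; after the actions $(i,j)$ move to the state $(x_{ij},Q_j,\zeta_j,\theta^+)$ (when $\theta_1=1$ the remaining stages have weight zero and what is played there is irrelevant). Optimal policies exist, and for every optimal policy and all $(x,Q,\zeta,\theta)$ with $\theta\in\Delta(\mathbb N^*)$ the strategy started at $(x,Q,\zeta,\theta)$ is optimal for player 2 in $\mathcal D[\mathcal G_\theta](x,Q;\zeta)$. 4. Every $\pi\in\Delta(K\times L)$, possibly dependent, is of the form $p\otimes Q$. For all $(p,Q)$ and $\theta$, the function $p'\mapsto v_\theta(p'\otimes Q)$ on $\Delta(K)$ (extended by $-\infty$ to $\mathbb R^K$) has a supergradient at $p$; and for every supergradient $x$ at $p$ and every optimal policy, the Markovian strategy started at $(x,Q,\mathbf 1,\theta)$ is optimal for player 2 in $\mathcal G_\theta(p\otimes Q)$. -/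

import Mathlib

open MeasureTheory ProbabilityTheory

noncomputable section

namespace RepeatedGame

/-! ## Plays, histories, strategies -/

/-- The pair of actions `(i, j)` played at one stage. -/
@[ext]
structure Outcome (I J : Type*) where
  /-- the action of player 1 -/
  i : I
  /-- the action of player 2 -/
  j : J

/-- The discrete sigma-algebra. -/
instance (I J : Type*) : MeasurableSpace (Outcome I J) := ⊤

instance (I J : Type*) : DiscreteMeasurableSpace (Outcome I J) := ⟨fun _ => trivial⟩

instance (I J : Type*) [Finite I] [Finite J] : Finite (Outcome I J) :=
  Finite.of_injective (fun o : Outcome I J => (o.i, o.j)) fun _ _ h =>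
    Outcome.ext (Prod.ext_iff.1 h).1 (Prod.ext_iff.1 h).2

/-- A strategy of a player with types in `A` and actions in `B`: a mixed action for each type and
each finite history (the list, in chronological order, of the pairs of actions played so far). -/
abbrev Strategy (A I J B : Type*) [Fintype B] : Type _ := A → List (Outcome I J) → stdSimplex ℝ B

section Plays

variable {I J : Type*} [Fintype I] [Fintype J]

/-- The law of a pair of independent actions drawn from the mixed actions `a` and `b`. -/
def mixedOutcome (a : stdSimplex ℝ I) (b : stdSimplex ℝ J) : Measure (Outcome I J) :=
  ∑ i, ∑ j, ENNReal.ofReal (a i * b j) • Measure.dirac (Outcome.mk i j)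

instance (a : stdSimplex ℝ I) (b : stdSimplex ℝ J) : IsProbabilityMeasure (mixedOutcome a b) := by
  constructor
  have h : ∀ i j, 0 ≤ a i * b j := fun i j =>
    mul_nonneg (stdSimplex.zero_le a i) (stdSimplex.zero_le b j)
  have h2 : ∑ i, ∑ j, a i * b j = 1 := by
    simp [← Finset.mul_sum, stdSimplex.sum_eq_one]
  simp only [mixedOutcome, Measure.coe_finsetSum, Finset.sum_apply, Measure.smul_apply,
    measure_univ, smul_eq_mul, mul_one]
  rw [Finset.sum_congr rfl fun i _ => (ENNReal.ofReal_sum_of_nonneg fun j _ => h i j).symm,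
    ← ENNReal.ofReal_sum_of_nonneg fun i _ => Finset.sum_nonneg fun j _ => h i j, h2,
    ENNReal.ofReal_one]

/-- The first `n + 1` stages of a play, as a list. -/
def toHistory {n : ℕ} (ω : (m : Finset.Iic n) → Outcome I J) : List (Outcome I J) :=
  List.ofFn fun m : Fin (n + 1) => ω ⟨m, Finset.mem_Iic.2 (Nat.lt_succ_iff.1 m.2)⟩

/-- The transition probability giving the next pair of actions after `n + 1` stages, when the
(behavioural) strategies of the realized types are `f` and `g`. -/
def transition (f : List (Outcome I J) → stdSimplex ℝ I) (g : List (Outcome I J) → stdSimplex ℝ J) (n : ℕ) :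
    Kernel ((m : Finset.Iic n) → Outcome I J) (Outcome I J) where
  toFun ω := mixedOutcome (f (toHistory ω)) (g (toHistory ω))
  measurable' := measurable_of_countable _

instance (f : List (Outcome I J) → stdSimplex ℝ I) (g : List (Outcome I J) → stdSimplex ℝ J) (n : ℕ) :
    IsMarkovKernel (transition f g n) :=
  ⟨fun _ => inferInstanceAs (IsProbabilityMeasure (mixedOutcome _ _))⟩

/-- The probability on the infinite plays `(I × J)^∞` induced by the behavioural strategies `f`
and `g` of the realized types. -/
def playLaw (f : List (Outcome I J) → stdSimplex ℝ I) (g : List (Outcome I J) → stdSimplex ℝ J) :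
    Measure (ℕ → Outcome I J) :=
  Kernel.trajMeasure (X := fun _ => Outcome I J) (mixedOutcome (f []) (g [])) (transition f g)

end Plays

/-! ## Evaluations -/

/-- `θ` is a probability on the positive integers; `θ m` is the weight of stage `m + 1`. -/
def IsEvaluation (θ : ℕ → ℝ) : Prop := (∀ m, 0 ≤ θ m) ∧ HasSum θ 1

/-- The normalized evaluation of the stages after the first one. When the first stage has weight
`1` this is the zero sequence, so that every payoff of the continuation game is `0`. -/
def shift (θ : ℕ → ℝ) : ℕ → ℝ := fun m => θ (m + 1) / (1 - θ 0)

/-! ## Primal and dual games -/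

section Games

variable {K L I J : Type*} [Fintype K] [Fintype L] [Fintype I] [Fintype J]

/-- The probability `p ⊗ Q` on `K × L`. -/
def prodCond (p : stdSimplex ℝ K) (Q : K → stdSimplex ℝ L) : stdSimplex ℝ (K × L) :=
  ⟨fun kl => p kl.1 * Q kl.1 kl.2,
    fun kl => mul_nonneg (stdSimplex.zero_le p kl.1) (stdSimplex.zero_le (Q kl.1) kl.2), by
      simp [Fintype.sum_prod_type, ← Finset.mul_sum, stdSimplex.sum_eq_one]⟩

/-- The payoff of the auxiliary game with prior `π`, weights `ζ` and evaluation `θ`: the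
expectation of `∑ₘ θₘ ζᵏ Gᵏˡ(iₘ, jₘ)`. -/
def payoff (G : K → L → I → J → ℝ) (π : stdSimplex ℝ (K × L)) (ζ : K → ℝ) (θ : ℕ → ℝ)
    (s : Strategy K I J I) (t : Strategy L I J J) : ℝ :=
  ∑ k, ∑ l, π (k, l) *
    ∫ ω, (∑' m, θ m * (ζ k * G k l (ω m).i (ω m).j)) ∂(playLaw (s k) (t l))

/-- The maxmin of the auxiliary (primal) game. -/
def primalMaxmin (G : K → L → I → J → ℝ) (π : stdSimplex ℝ (K × L)) (ζ : K → ℝ) (θ : ℕ → ℝ) : ℝ :=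
  ⨆ s : Strategy K I J I, ⨅ t : Strategy L I J J, payoff G π ζ θ s t

/-- The minmax of the auxiliary (primal) game. -/
def primalMinmax (G : K → L → I → J → ℝ) (π : stdSimplex ℝ (K × L)) (ζ : K → ℝ) (θ : ℕ → ℝ) : ℝ :=
  ⨅ t : Strategy L I J J, ⨆ s : Strategy K I J I, payoff G π ζ θ s t

/-- The payoff of the auxiliary dual game: player 1 also chooses `p`, at cost `⟨p, x⟩`. -/
def dualPayoff (G : K → L → I → J → ℝ) (x : K → ℝ) (Q : K → stdSimplex ℝ L) (ζ : K → ℝ)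
    (θ : ℕ → ℝ) (p : stdSimplex ℝ K) (s : Strategy K I J I) (t : Strategy L I J J) : ℝ :=
  payoff G (prodCond p Q) ζ θ s t - ∑ k, p k * x k

/-- The maxmin of the auxiliary dual game. -/
def dualMaxmin (G : K → L → I → J → ℝ) (x : K → ℝ) (Q : K → stdSimplex ℝ L) (ζ : K → ℝ)
    (θ : ℕ → ℝ) : ℝ :=
  ⨆ ps : stdSimplex ℝ K × Strategy K I J I, ⨅ t : Strategy L I J J,
    dualPayoff G x Q ζ θ ps.1 ps.2 t

/-- The minmax of the auxiliary dual game. -/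
def dualMinmax (G : K → L → I → J → ℝ) (x : K → ℝ) (Q : K → stdSimplex ℝ L) (ζ : K → ℝ)
    (θ : ℕ → ℝ) : ℝ :=
  ⨅ t : Strategy L I J J, ⨆ ps : stdSimplex ℝ K × Strategy K I J I,
    dualPayoff G x Q ζ θ ps.1 ps.2 t

/-- `t` is an optimal strategy of player 2 in the repeated game with prior `π`: it guarantees that
the payoff does not exceed the value. -/
def IsOptimalPrimal (G : K → L → I → J → ℝ) (π : stdSimplex ℝ (K × L)) (θ : ℕ → ℝ)
    (t : Strategy L I J J) : Prop :=
  ∀ s : Strategy K I J I, payoff G π 1 θ s t ≤ primalMinmax G π 1 θ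

/-- `t` is an optimal strategy of player 2 in the auxiliary dual game. -/
def IsOptimalDual (G : K → L → I → J → ℝ) (x : K → ℝ) (Q : K → stdSimplex ℝ L) (ζ : K → ℝ)
    (θ : ℕ → ℝ) (t : Strategy L I J J) : Prop :=
  ∀ (p : stdSimplex ℝ K) (s : Strategy K I J I),
    dualPayoff G x Q ζ θ p s t ≤ dualMinmax G x Q ζ θ

/-- `x` is a supergradient at `p` of the function `v` on the simplex (extended by `-∞`). -/
def IsSupergradient (v : stdSimplex ℝ K → ℝ) (p : stdSimplex ℝ K) (x : K → ℝ) : Prop :=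
  ∀ p' : stdSimplex ℝ K, v p' ≤ v p + ∑ k, x k * (p' k - p k)

/-! ## The one-step problem of player 2 -/

/-- `ℙ(j | k)`, the probability of the action `j` given the type `k`. -/
def actionProb (Q : K → stdSimplex ℝ L) (τ : L → stdSimplex ℝ J) (j : J) (k : K) : ℝ :=
  ∑ l, Q k l * τ l j

open Classical in
/-- The updated conditional matrix `Qⱼ`, given by Bayes' rule; where the conditional probability
is undefined (`ℙ(j | k) = 0`) the row is left unchanged. -/
def updateQ (Q : K → stdSimplex ℝ L) (τ : L → stdSimplex ℝ J) (j : J) (k : K) : stdSimplex ℝ L :=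
  if h : actionProb Q τ j k = 0 then Q k
  else ⟨fun l => Q k l * τ l j / actionProb Q τ j k,
    fun l => div_nonneg (mul_nonneg (stdSimplex.zero_le (Q k) l) (stdSimplex.zero_le (τ l) j))
      (Finset.sum_nonneg fun l _ =>
        mul_nonneg (stdSimplex.zero_le (Q k) l) (stdSimplex.zero_le (τ l) j)), by
      rw [← Finset.sum_div]; exact div_self h⟩

/-- The updated weights `ζⱼᵏ = ζᵏ ℙ(j | k)`. -/
def updateWeight (Q : K → stdSimplex ℝ L) (ζ : K → ℝ) (τ : L → stdSimplex ℝ J) (j : J) : K → ℝ :=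
  fun k => ζ k * actionProb Q τ j k

/-- The expected first-stage payoff of the auxiliary game given the type `k` and the action `i` of
player 1: `ζᵏ Gᵏ_{iτ} = ζᵏ ∑_{l, j} Q(l | k) τˡ(j) Gᵏˡ(i, j)`. -/
def stagePayoff (G : K → L → I → J → ℝ) (Q : K → stdSimplex ℝ L) (ζ : K → ℝ)
    (τ : L → stdSimplex ℝ J) (i : I) : K → ℝ :=
  fun k => ζ k * ∑ l, ∑ j, Q k l * τ l j * G k l i j

/-- The families `(x_{ij})` with
`∑ⱼ x_{ij} = (x - θ₁ ζ·G_{iτ}) / (1 - θ₁)` for every `i`. -/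
def splittings (G : K → L → I → J → ℝ) (x : K → ℝ) (Q : K → stdSimplex ℝ L) (ζ : K → ℝ)
    (θ : ℕ → ℝ) (τ : L → stdSimplex ℝ J) : Set (I → J → K → ℝ) :=
  {y | ∀ i k, ∑ j, y i j k = (x k - θ 0 * stagePayoff G Q ζ τ i k) / (1 - θ 0)}

/-- `maxᵢ ∑ⱼ w_{θ⁺}(x_{ij}, Qⱼ; ζⱼ)`. -/
def continuationMax (G : K → L → I → J → ℝ) (Q : K → stdSimplex ℝ L) (ζ : K → ℝ)
    (θ : ℕ → ℝ) (τ : L → stdSimplex ℝ J) (y : I → J → K → ℝ) : ℝ :=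
  ⨆ i, ∑ j, dualMinmax G (y i j) (updateQ Q τ j) (updateWeight Q ζ τ j) (shift θ)

/-- `max_{i, k} (ζᵏ Gᵏ_{iτ} - xᵏ)`: what player 1 can get against `τ` in the dual game when the
first stage carries the whole weight. -/
def oneStageMax (G : K → L → I → J → ℝ) (x : K → ℝ) (Q : K → stdSimplex ℝ L) (ζ : K → ℝ)
    (τ : L → stdSimplex ℝ J) : ℝ :=
  ⨆ ik : I × K, (stagePayoff G Q ζ τ ik.1 ik.2 - x ik.2)

/-! ## Markovian strategies of player 2 -/

/-- The variables that a Markovian strategy depends on. -/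
structure State (K L : Type*) [Fintype L] where
  /-- the cost vector -/
  x : K → ℝ
  /-- the conditional matrix -/
  Q : K → stdSimplex ℝ L
  /-- the weights -/
  ζ : K → ℝ
  /-- the normalized evaluation of the remaining stages -/
  θ : ℕ → ℝ

/-- A rule choosing, at each state, a one-stage strategy `τ` and a family `(x_{ij})`. -/
abbrev Policy (K L I J : Type*) [Fintype L] [Fintype J] : Type _ :=
  State K L → (L → stdSimplex ℝ J) × (I → J → K → ℝ)

/-- The state that follows `a` when the policy is used and the actions `i`, `j` are played:
`(x_{ij}, Qⱼ, ζⱼ, θ⁺)`. -/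
def Policy.next (P : Policy K L I J) (a : State K L) (i : I) (j : J) : State K L where
  x := (P a).2 i j
  Q := updateQ a.Q (P a).1 j
  ζ := updateWeight a.Q a.ζ (P a).1 j
  θ := shift a.θ

/-- The strategy of player 2 that plays the policy's `τ` at the current state and updates the
state after each stage. -/
def Policy.strategy (P : Policy K L I J) : State K L → Strategy L I J J
  | a, l, [] => (P a).1 l
  | a, l, o :: h => Policy.strategy P (P.next a o.i o.j) l h

/-- At every state the policy picks a minimizer of the recursive formula (if some weight remains
after the current stage) or of the one-stage dual game (if none does). -/
def Policy.IsOptimal (G : K → L → I → J → ℝ) (P : Policy K L I J) : Prop :=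
  ∀ a : State K L, IsEvaluation a.θ →
    (a.θ 0 < 1 →
      (P a).2 ∈ splittings G a.x a.Q a.ζ a.θ (P a).1 ∧
      ∀ τ, ∀ y ∈ splittings G a.x a.Q a.ζ a.θ τ,
        continuationMax G a.Q a.ζ a.θ (P a).1 (P a).2 ≤ continuationMax G a.Q a.ζ a.θ τ y) ∧
    (a.θ 0 = 1 → ∀ τ, oneStageMax G a.x a.Q a.ζ (P a).1 ≤ oneStageMax G a.x a.Q a.ζ τ)

end Games

end RepeatedGame

end

/-!
Player 2's side of the game is described by the vector of the best payoffs `bestPayoff … k t`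
that the types `k` of player 1 can get against a strategy `t`. In the dual game player 1 chooses
the law of `k` himself, hence `t` guarantees `maxₖ (bestPayoff … k t - x k)` (`dualGuarantee`),
and the dual value is the minimum of this over `t`. The minimum exists because behavioural
strategies form a compact product of simplices on which this guarantee is lower semicontinuous.

Each type of player 1 faces a one-player problem against `t`, so that `bestPayoff` satisfies
Bellman's equation (`bestPayoff_le_iff`): after the first stage, the type `k` faces the
continuation of `t` with the updated data `Qⱼ`, `ζⱼ` and `θ⁺`. The dual recursive formula is
this equation read in both directions. Gluing, behind a first-stage action `τ`, strategies that
are optimal in the dual games at a splitting `(x_{ij})` gives one inequality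
(`exists_dualGuarantee_le`). Conversely, the vectors guaranteed by the continuations of `t`,
increased by a suitable slack, form a splitting (`exists_continuationMax_le`). Minimizing over
all the strategies with a given first-stage action shows that the minima are attained.

For a Markovian strategy, using the formula at the first `n` stages shows that the loss with
respect to the dual value is at most of the order of the weight of the stages after the first
`n` (`bestPayoff_strategy_le_add_tail`), which tends to zero.

The values exist by a minmax theorem (`iSup_iInf_eq_iInf_iSup`) that needs only compactness,
continuity, and that mixtures of strategies be available to both players. Behavioural strategies
have this property since a mixture of two of them is equivalent to the behavioural strategy that
updates the mixing weights by Bayes' rule along the player's own actions (`mixStrategy`).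

Finally, the dual value is the conjugate of the primal one in the marginal law `p`. So a
strategy that is optimal in the dual game at a supergradient is optimal in the primal game
(`payoff_le_of_dualGuarantee_le`), and the best payoffs against a primal optimal strategy form a
supergradient (`exists_isSupergradient`).
-/

noncomputable section

namespace RepeatedGame

/-! ### The law of a play, one stage at a time -/

section PlayLaw

variable {I J : Type*} [Fintype I] [Fintype J]

/-- The first `n` stages of a play, as a list. -/
def initialHistory (n : ℕ) (ω : ℕ → Outcome I J) : List (Outcome I J) :=
  List.ofFn fun m : Fin n => ω m

/-- The expectation of a function of the first `n` pairs of actions, computed by conditioning on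
the first stage. -/
def historyExp : ℕ → (List (Outcome I J) → stdSimplex ℝ I) → (List (Outcome I J) → stdSimplex ℝ J) →
    (List (Outcome I J) → ℝ) → ℝ
  | 0, _, _, F => F []
  | n + 1, f, g, F => ∑ i, ∑ j, f [] i * g [] j *
      historyExp n (fun h => f (⟨i, j⟩ :: h)) (fun h => g (⟨i, j⟩ :: h)) fun h => F (⟨i, j⟩ :: h)

/-- Conditioning on the last stage instead of the first one. -/
theorem historyExp_succ' (n : ℕ) (f : List (Outcome I J) → stdSimplex ℝ I)
    (g : List (Outcome I J) → stdSimplex ℝ J) (F : List (Outcome I J) → ℝ) :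
    historyExp (n + 1) f g F =
      historyExp n f g fun h => ∑ i, ∑ j, f h i * g h j * F (h ++ [⟨i, j⟩]) := by
  induction n generalizing f g F with
  | zero => simp [historyExp]
  | succ n ih =>
    rw [historyExp, historyExp]
    exact Finset.sum_congr rfl fun i _ => Finset.sum_congr rfl fun j _ => by rw [ih]; rfl

theorem integral_mixedOutcome (a : stdSimplex ℝ I) (b : stdSimplex ℝ J) (F : Outcome I J → ℝ) :
    ∫ o, F o ∂(mixedOutcome a b) = ∑ i, ∑ j, a i * b j * F ⟨i, j⟩ := by
  have hint : ∀ i j, Integrable F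
      (ENNReal.ofReal (a i * b j) • Measure.dirac (Outcome.mk i j)) := fun i j =>
    (integrable_dirac (by simp)).smul_measure ENNReal.ofReal_ne_top
  rw [mixedOutcome, integral_finsetSum_measure fun i _ => integrable_finsetSum_measure.2
    fun j _ => hint i j]
  refine Finset.sum_congr rfl fun i _ => ?_
  rw [integral_finsetSum_measure fun j _ => hint i j]
  refine Finset.sum_congr rfl fun j _ => ?_
  rw [integral_smul_measure, integral_dirac, ENNReal.toReal_ofReal
    (mul_nonneg (stdSimplex.zero_le a i) (stdSimplex.zero_le b j)), smul_eq_mul]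

instance (f : List (Outcome I J) → stdSimplex ℝ I) (g : List (Outcome I J) → stdSimplex ℝ J) :
    IsProbabilityMeasure (playLaw f g) := by
  unfold playLaw; infer_instance

theorem playLaw_map_zero (f : List (Outcome I J) → stdSimplex ℝ I)
    (g : List (Outcome I J) → stdSimplex ℝ J) :
    (playLaw f g).map (fun ω => ω 0) = mixedOutcome (f []) (g []) := by
  have h : (playLaw f g).map (Preorder.frestrictLe (π := fun _ : ℕ => Outcome I J) 0) =
      (mixedOutcome (f []) (g [])).map (MeasurableEquiv.piUnique
        (fun _ : Finset.Iic 0 => Outcome I J)).symm := by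
    rw [playLaw, Kernel.trajMeasure, Measure.map_comp _ _ (by fun_prop),
      Kernel.traj_map_frestrictLe, Kernel.partialTraj_self, Measure.id_comp]
  have h2 : (fun ω : ℕ → Outcome I J => ω 0) =
      (fun x : (m : Finset.Iic 0) → Outcome I J => x ⟨0, by simp⟩) ∘
        (Preorder.frestrictLe (π := fun _ : ℕ => Outcome I J) 0) := rfl
  rw [h2, ← Measure.map_map (by fun_prop) (by fun_prop), h, Measure.map_map (by fun_prop)
    (by fun_prop)]
  exact Measure.map_id

/-- The expectation of a function of finitely many stages under the law of the play. -/
theorem integral_initialHistory (n : ℕ) (f : List (Outcome I J) → stdSimplex ℝ I)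
    (g : List (Outcome I J) → stdSimplex ℝ J) (F : List (Outcome I J) → ℝ) :
    ∫ ω, F (initialHistory (n + 1) ω) ∂(playLaw f g) = historyExp (n + 1) f g F := by
  induction n generalizing F with
  | zero =>
    have h : ∀ ω : ℕ → Outcome I J, F (initialHistory (0 + 1) ω) = (fun o => F [o]) (ω 0) := by
      intro ω; simp [initialHistory]
    simp only [h]
    rw [← integral_map (φ := fun ω : ℕ → Outcome I J => ω 0) (f := fun o => F [o])
      (measurable_pi_apply 0).aemeasurable (measurable_of_countable _).aestronglyMeasurable,
      playLaw_map_zero,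
      integral_mixedOutcome]
    simp [historyExp]
  | succ n ih =>
    rw [historyExp_succ', ← ih]
    let Φ : ((m : Finset.Iic n) → Outcome I J) × Outcome I J → ℝ :=
      fun z => F (toHistory z.1 ++ [z.2])
    have hΦ : Measurable Φ := measurable_of_countable _
    have h : ∀ ω : ℕ → Outcome I J, F (initialHistory (n + 1 + 1) ω) =
        Φ (Preorder.frestrictLe n ω, ω (n + 1)) := by
      intro ω
      simp only [Φ, initialHistory, toHistory, Preorder.frestrictLe_apply]
      rw [List.ofFn_succ_last]
      rfl
    simp only [h]
    rw [← integral_map (φ := fun ω : ℕ → Outcome I J =>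
        ((Preorder.frestrictLe n ω : (m : Finset.Iic n) → Outcome I J), ω (n + 1)))
      (f := Φ) (by fun_prop) hΦ.aestronglyMeasurable]
    have key := Kernel.map_frestrictLe_trajMeasure_compProd_eq_map_trajMeasure
      (X := fun _ => Outcome I J) (μ₀ := mixedOutcome (f []) (g [])) (κ := transition f g) (a := n)
    rw [playLaw, ← key, Measure.integral_compProd, integral_map (by fun_prop)
      (measurable_of_countable _).aestronglyMeasurable]
    · refine integral_congr_ae (Filter.Eventually.of_forall fun ω => ?_)
      exact integral_mixedOutcome _ _ _
    · have : IsProbabilityMeasure ((Kernel.trajMeasure (X := fun _ => Outcome I J)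
          (mixedOutcome (f []) (g [])) (transition f g)).map (Preorder.frestrictLe n)) :=
        Measure.isProbabilityMeasure_map (by fun_prop)
      exact Integrable.of_finite

/-- The expected payoff of stage `m + 1` in the game with payoff matrix `A`, computed by
conditioning on the first stage. -/
def stageExp (A : I → J → ℝ) : ℕ → (List (Outcome I J) → stdSimplex ℝ I) →
    (List (Outcome I J) → stdSimplex ℝ J) → ℝ
  | 0, f, g => ∑ i, ∑ j, f [] i * g [] j * A i j
  | m + 1, f, g => ∑ i, ∑ j, f [] i * g [] j *
      stageExp A m (fun h => f (⟨i, j⟩ :: h)) fun h => g (⟨i, j⟩ :: h)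

theorem integral_stage (A : I → J → ℝ) (m : ℕ) (f : List (Outcome I J) → stdSimplex ℝ I)
    (g : List (Outcome I J) → stdSimplex ℝ J) :
    ∫ ω, A (ω m).i (ω m).j ∂(playLaw f g) = stageExp A m f g := by
  let F : ℕ → List (Outcome I J) → ℝ := fun m h => (h[m]?).elim 0 fun o => A o.i o.j
  have h1 : ∀ ω : ℕ → Outcome I J, A (ω m).i (ω m).j = F m (initialHistory (m + 1) ω) := by
    intro ω
    simp [F, initialHistory, -List.ofFn_succ]
  simp only [h1]
  rw [integral_initialHistory]
  clear h1
  induction m generalizing f g with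
  | zero => simp [historyExp, stageExp, F]
  | succ m ih =>
    rw [historyExp, stageExp]
    refine Finset.sum_congr rfl fun i _ => Finset.sum_congr rfl fun j _ => ?_
    rw [← ih]
    rfl

end PlayLaw

/-! ### Weighted sums of stage payoffs -/

section Weighted

variable {I J : Type*} [Fintype I] [Fintype J]

theorem sum_sum_mul_eq_one (a : stdSimplex ℝ I) (b : stdSimplex ℝ J) :
    ∑ i, ∑ j, a i * b j = 1 := by
  simp [← Finset.mul_sum, stdSimplex.sum_eq_one]

theorem abs_sum_sum_mul_le (a : stdSimplex ℝ I) (b : stdSimplex ℝ J) {F : I → J → ℝ} {C : ℝ}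
    (hF : ∀ i j, |F i j| ≤ C) : |∑ i, ∑ j, a i * b j * F i j| ≤ C := by
  calc |∑ i, ∑ j, a i * b j * F i j|
      ≤ ∑ i, ∑ j, a i * b j * C := by
        refine (Finset.abs_sum_le_sum_abs _ _).trans (Finset.sum_le_sum fun i _ => ?_)
        refine (Finset.abs_sum_le_sum_abs _ _).trans (Finset.sum_le_sum fun j _ => ?_)
        have h : 0 ≤ a i * b j := mul_nonneg (stdSimplex.zero_le a i) (stdSimplex.zero_le b j)
        rw [abs_mul, abs_of_nonneg h]
        exact mul_le_mul_of_nonneg_left (hF i j) h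
    _ = C := by simp only [← Finset.sum_mul, sum_sum_mul_eq_one, one_mul]

theorem abs_stageExp_le {A : I → J → ℝ} {C : ℝ} (hA : ∀ i j, |A i j| ≤ C) (m : ℕ)
    (f : List (Outcome I J) → stdSimplex ℝ I) (g : List (Outcome I J) → stdSimplex ℝ J) :
    |stageExp A m f g| ≤ C := by
  induction m generalizing f g with
  | zero => exact abs_sum_sum_mul_le _ _ hA
  | succ m ih => exact abs_sum_sum_mul_le _ _ fun i j => ih _ _

theorem exists_abs_le (A : I → J → ℝ) : ∃ C, ∀ i j, |A i j| ≤ C := by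
  obtain ⟨C, hC⟩ := (Set.finite_range fun ij : I × J => |A ij.1 ij.2|).bddAbove
  exact ⟨C, fun i j => hC ⟨(i, j), rfl⟩⟩

/-- The expectation of `∑ₘ θₘ A(iₘ, jₘ)`. -/
def weightedExp (A : I → J → ℝ) (θ : ℕ → ℝ) (f : List (Outcome I J) → stdSimplex ℝ I)
    (g : List (Outcome I J) → stdSimplex ℝ J) : ℝ :=
  ∑' m, θ m * stageExp A m f g

theorem summable_mul_of_abs_le {θ u : ℕ → ℝ} {C : ℝ} (hθ : Summable θ) (hu : ∀ m, |u m| ≤ C) :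
    Summable fun m => θ m * u m :=
  Summable.of_norm_bounded (hθ.abs.mul_right C) fun m => by
    rw [Real.norm_eq_abs, abs_mul]
    exact mul_le_mul_of_nonneg_left (hu m) (abs_nonneg _)

theorem summable_mul_stageExp (A : I → J → ℝ) {θ : ℕ → ℝ} (hθ : Summable θ)
    (f : List (Outcome I J) → stdSimplex ℝ I) (g : List (Outcome I J) → stdSimplex ℝ J) :
    Summable fun m => θ m * stageExp A m f g := by
  obtain ⟨C, hC⟩ := exists_abs_le A
  exact summable_mul_of_abs_le hθ fun m => abs_stageExp_le hC m f g

theorem integral_weighted (A : I → J → ℝ) {θ : ℕ → ℝ} (hθ : Summable θ) (z : ℝ)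
    (f : List (Outcome I J) → stdSimplex ℝ I) (g : List (Outcome I J) → stdSimplex ℝ J) :
    ∫ ω, (∑' m, θ m * (z * A (ω m).i (ω m).j)) ∂(playLaw f g) = z * weightedExp A θ f g := by
  obtain ⟨C, hC⟩ := exists_abs_le A
  have hmeas : ∀ m, Measurable fun ω : ℕ → Outcome I J => θ m * (z * A (ω m).i (ω m).j) := fun m =>
    (measurable_of_countable fun o : Outcome I J => θ m * (z * A o.i o.j)).comp
      (measurable_pi_apply m)
  have hbound : ∀ m (ω : ℕ → Outcome I J), ‖θ m * (z * A (ω m).i (ω m).j)‖ ≤ |θ m| * (|z| * C) := by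
    intro m ω
    rw [Real.norm_eq_abs, abs_mul, abs_mul]
    exact mul_le_mul_of_nonneg_left (mul_le_mul_of_nonneg_left (hC _ _) (abs_nonneg _))
      (abs_nonneg _)
  have hint : ∀ m, Integrable (fun ω => θ m * (z * A (ω m).i (ω m).j)) (playLaw f g) := fun m =>
    Integrable.of_bound (hmeas m).aestronglyMeasurable _ (Filter.Eventually.of_forall (hbound m))
  rw [← integral_tsum_of_summable_integral_norm hint]
  · simp only [integral_const_mul, integral_stage, weightedExp]
    rw [← tsum_mul_left]
    exact tsum_congr fun m => by ring
  · refine Summable.of_nonneg_of_le (fun m => integral_nonneg fun ω => norm_nonneg _) (fun m => ?_)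
      (hθ.abs.mul_right (|z| * C))
    refine (integral_mono (hint m).norm (integrable_const _) (hbound m)).trans ?_
    simp

/-- Conditioning the weighted payoff on the first stage. -/
theorem weightedExp_eq (A : I → J → ℝ) {θ : ℕ → ℝ} (hθ : Summable θ)
    (f : List (Outcome I J) → stdSimplex ℝ I) (g : List (Outcome I J) → stdSimplex ℝ J) :
    weightedExp A θ f g = ∑ i, ∑ j, f [] i * g [] j * (θ 0 * A i j +
      weightedExp A (fun m => θ (m + 1)) (fun h => f (⟨i, j⟩ :: h)) fun h => g (⟨i, j⟩ :: h)) := by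
  have hθ' : Summable fun m => θ (m + 1) := (summable_nat_add_iff 1).2 hθ
  have hs := fun i j => (summable_mul_stageExp A hθ' (fun h => f (⟨i, j⟩ :: h))
    fun h => g (⟨i, j⟩ :: h)).mul_left (f [] i * g [] j)
  rw [weightedExp, (summable_mul_stageExp A hθ f g).tsum_eq_zero_add]
  simp only [mul_add, Finset.sum_add_distrib, weightedExp]
  congr 1
  · simp only [stageExp, Finset.mul_sum]
    exact Finset.sum_congr rfl fun i _ => Finset.sum_congr rfl fun j _ => by ring
  · simp only [← tsum_mul_left]
    rw [Finset.sum_congr rfl fun i _ => (Summable.tsum_finsetSum fun j _ => hs i j).symm,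
      ← Summable.tsum_finsetSum fun i _ => summable_sum fun j _ => hs i j]
    refine tsum_congr fun m => ?_
    simp only [stageExp, Finset.mul_sum]
    exact Finset.sum_congr rfl fun i _ => Finset.sum_congr rfl fun j _ => by ring

theorem weightedExp_const_mul (A : I → J → ℝ) (c : ℝ) (θ : ℕ → ℝ)
    (f : List (Outcome I J) → stdSimplex ℝ I) (g : List (Outcome I J) → stdSimplex ℝ J) :
    weightedExp A (fun m => c * θ m) f g = c * weightedExp A θ f g := by
  simp only [weightedExp, mul_assoc, tsum_mul_left]

theorem abs_weightedExp_le {A : I → J → ℝ} {C : ℝ} (hA : ∀ i j, |A i j| ≤ C) {θ : ℕ → ℝ}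
    (hθ : IsEvaluation θ)
    (f : List (Outcome I J) → stdSimplex ℝ I) (g : List (Outcome I J) → stdSimplex ℝ J) :
    |weightedExp A θ f g| ≤ C := by
  have h : HasSum (fun m => θ m * C) C := by simpa using hθ.2.mul_right C
  have := tsum_of_norm_bounded h (f := fun m => θ m * stageExp A m f g) fun m => by
    rw [Real.norm_eq_abs, abs_mul, abs_of_nonneg (hθ.1 m)]
    exact mul_le_mul_of_nonneg_left (abs_stageExp_le hA m f g) (hθ.1 m)
  exact this

/-! ### Continuity -/

theorem continuous_stdSimplex_apply {B : Type*} [Fintype B] (b : B) :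
    Continuous fun a : stdSimplex ℝ B => a b :=
  (continuous_apply b).comp continuous_subtype_val

theorem continuous_stageExp {X : Type*} [TopologicalSpace X] (A : I → J → ℝ) (m : ℕ)
    {f : X → List (Outcome I J) → stdSimplex ℝ I} {g : X → List (Outcome I J) → stdSimplex ℝ J}
    (hf : Continuous f) (hg : Continuous g) : Continuous fun x => stageExp A m (f x) (g x) := by
  have hf0 : ∀ i, Continuous fun x => f x [] i := fun i =>
    (continuous_stdSimplex_apply i).comp ((continuous_apply []).comp hf)
  have hg0 : ∀ j, Continuous fun x => g x [] j := fun j =>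
    (continuous_stdSimplex_apply j).comp ((continuous_apply []).comp hg)
  induction m generalizing f g with
  | zero =>
    exact continuous_finsetSum _ fun i _ => continuous_finsetSum _ fun j _ =>
      ((hf0 i).mul (hg0 j)).mul continuous_const
  | succ m ih =>
    refine continuous_finsetSum _ fun i _ => continuous_finsetSum _ fun j _ =>
      ((hf0 i).mul (hg0 j)).mul ?_
    have hf' : Continuous fun x h => f x (⟨i, j⟩ :: h) :=
      continuous_pi fun h => (continuous_apply _).comp hf
    have hg' : Continuous fun x h => g x (⟨i, j⟩ :: h) :=
      continuous_pi fun h => (continuous_apply _).comp hg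
    exact ih hf' hg'
      (fun i => (continuous_stdSimplex_apply i).comp ((continuous_apply []).comp hf'))
      (fun j => (continuous_stdSimplex_apply j).comp ((continuous_apply []).comp hg'))

theorem continuous_weightedExp {X : Type*} [TopologicalSpace X] (A : I → J → ℝ) {θ : ℕ → ℝ}
    (hθ : Summable θ) {f : X → List (Outcome I J) → stdSimplex ℝ I}
    {g : X → List (Outcome I J) → stdSimplex ℝ J} (hf : Continuous f) (hg : Continuous g) :
    Continuous fun x => weightedExp A θ (f x) (g x) := by
  obtain ⟨C, hC⟩ := exists_abs_le A
  refine continuous_tsum (fun m => continuous_const.mul (continuous_stageExp A m hf hg))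
    (hθ.abs.mul_right C) fun m x => ?_
  rw [Real.norm_eq_abs, abs_mul]
  exact mul_le_mul_of_nonneg_left (abs_stageExp_le hC m _ _) (abs_nonneg _)

/-! ### Mixtures of behavioural strategies -/

open Classical in
/-- The mixed action proportional to `a • p + b • q`, for weights `a, b ≥ 0` that are not both zero
(and `p` otherwise). -/
def mixAction {B : Type*} [Fintype B] (a b : ℝ) (p q : stdSimplex ℝ B) : stdSimplex ℝ B :=
  if h : 0 ≤ a ∧ 0 ≤ b ∧ a + b ≠ 0 then
    ⟨fun x => (a * p x + b * q x) / (a + b),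
      fun x => div_nonneg (add_nonneg (mul_nonneg h.1 (stdSimplex.zero_le p x))
        (mul_nonneg h.2.1 (stdSimplex.zero_le q x))) (add_nonneg h.1 h.2.1), by
      rw [← Finset.sum_div, Finset.sum_add_distrib, ← Finset.mul_sum, ← Finset.mul_sum,
        stdSimplex.sum_eq_one, stdSimplex.sum_eq_one, mul_one, mul_one, div_self h.2.2]⟩
  else p

theorem add_mul_mixAction {B : Type*} [Fintype B] {a b : ℝ} (ha : 0 ≤ a) (hb : 0 ≤ b)
    (p q : stdSimplex ℝ B) (x : B) : (a + b) * mixAction a b p q x = a * p x + b * q x := by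
  rcases eq_or_ne (a + b) 0 with h | h
  · obtain ⟨rfl, rfl⟩ := (add_eq_zero_iff_of_nonneg ha hb).1 h
    simp
  · have h' : 0 ≤ a ∧ 0 ≤ b ∧ a + b ≠ 0 := ⟨ha, hb, h⟩
    have : mixAction a b p q x = (a * p x + b * q x) / (a + b) := by
      rw [mixAction, dif_pos h']; rfl
    rw [this, mul_div_cancel₀ _ h]

/-- The behavioural strategy equivalent to playing `f` with probability proportional to `a` and `f'`
with probability proportional to `b`. The weights are updated by Bayes' rule, which only involves
the player's own actions `own o`. -/
def mixStrategy {B : Type*} [Fintype B] (own : Outcome I J → B) :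
    ℝ → ℝ → (List (Outcome I J) → stdSimplex ℝ B) → (List (Outcome I J) → stdSimplex ℝ B) →
      List (Outcome I J) → stdSimplex ℝ B
  | a, b, f, f', [] => mixAction a b (f []) (f' [])
  | a, b, f, f', o :: h => mixStrategy own (a * f [] (own o)) (b * f' [] (own o))
      (fun h => f (o :: h)) (fun h => f' (o :: h)) h

theorem add_mul_stageExp_mixStrategy_left (A : I → J → ℝ) (m : ℕ) {a b : ℝ} (ha : 0 ≤ a)
    (hb : 0 ≤ b) (f f' : List (Outcome I J) → stdSimplex ℝ I)
    (g : List (Outcome I J) → stdSimplex ℝ J) :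
    (a + b) * stageExp A m (mixStrategy Outcome.i a b f f') g =
      a * stageExp A m f g + b * stageExp A m f' g := by
  have h0 := add_mul_mixAction ha hb (f []) (f' [])
  induction m generalizing a b f f' g with
  | zero =>
    simp only [stageExp, Finset.mul_sum, ← Finset.sum_add_distrib]
    refine Finset.sum_congr rfl fun i _ => Finset.sum_congr rfl fun j _ => ?_
    have := h0 i
    rw [mixStrategy]
    linear_combination g [] j * A i j * this
  | succ m ih =>
    simp only [stageExp, Finset.mul_sum, ← Finset.sum_add_distrib]
    refine Finset.sum_congr rfl fun i _ => Finset.sum_congr rfl fun j _ => ?_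
    have ha' := mul_nonneg ha (stdSimplex.zero_le (f []) i)
    have hb' := mul_nonneg hb (stdSimplex.zero_le (f' []) i)
    have h1 := ih ha' hb' (fun h => f (⟨i, j⟩ :: h)) (fun h => f' (⟨i, j⟩ :: h))
      (fun h => g (⟨i, j⟩ :: h)) (add_mul_mixAction ha' hb' _ _)
    have h2 := h0 i
    simp only [mixStrategy]
    linear_combination g [] j * h1 + g [] j * stageExp A m (mixStrategy Outcome.i (a * f [] i)
      (b * f' [] i) (fun h => f (⟨i, j⟩ :: h)) fun h => f' (⟨i, j⟩ :: h))
      (fun h => g (⟨i, j⟩ :: h)) * h2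

theorem add_mul_stageExp_mixStrategy_right (A : I → J → ℝ) (m : ℕ) {a b : ℝ} (ha : 0 ≤ a)
    (hb : 0 ≤ b) (f : List (Outcome I J) → stdSimplex ℝ I)
    (g g' : List (Outcome I J) → stdSimplex ℝ J) :
    (a + b) * stageExp A m f (mixStrategy Outcome.j a b g g') =
      a * stageExp A m f g + b * stageExp A m f g' := by
  have h0 := add_mul_mixAction ha hb (g []) (g' [])
  induction m generalizing a b f g g' with
  | zero =>
    simp only [stageExp, Finset.mul_sum, ← Finset.sum_add_distrib]
    refine Finset.sum_congr rfl fun i _ => Finset.sum_congr rfl fun j _ => ?_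
    have := h0 j
    rw [mixStrategy]
    linear_combination f [] i * A i j * this
  | succ m ih =>
    simp only [stageExp, Finset.mul_sum, ← Finset.sum_add_distrib]
    refine Finset.sum_congr rfl fun i _ => Finset.sum_congr rfl fun j _ => ?_
    have ha' := mul_nonneg ha (stdSimplex.zero_le (g []) j)
    have hb' := mul_nonneg hb (stdSimplex.zero_le (g' []) j)
    have h1 := ih ha' hb' (fun h => f (⟨i, j⟩ :: h)) (fun h => g (⟨i, j⟩ :: h))
      (fun h => g' (⟨i, j⟩ :: h)) (add_mul_mixAction ha' hb' _ _)
    have h2 := h0 j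
    simp only [mixStrategy]
    linear_combination f [] i * h1 + f [] i * stageExp A m (fun h => f (⟨i, j⟩ :: h))
      (mixStrategy Outcome.j (a * g [] j) (b * g' [] j) (fun h => g (⟨i, j⟩ :: h))
      fun h => g' (⟨i, j⟩ :: h)) * h2

theorem add_mul_weightedExp_mixStrategy_left (A : I → J → ℝ) {θ : ℕ → ℝ} (hθ : Summable θ)
    {a b : ℝ} (ha : 0 ≤ a) (hb : 0 ≤ b) (f f' : List (Outcome I J) → stdSimplex ℝ I)
    (g : List (Outcome I J) → stdSimplex ℝ J) :
    (a + b) * weightedExp A θ (mixStrategy Outcome.i a b f f') g =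
      a * weightedExp A θ f g + b * weightedExp A θ f' g := by
  simp only [weightedExp, ← tsum_mul_left]
  rw [← ((summable_mul_stageExp A hθ f g).mul_left a).tsum_add
    ((summable_mul_stageExp A hθ f' g).mul_left b)]
  refine tsum_congr fun m => ?_
  linear_combination θ m * add_mul_stageExp_mixStrategy_left A m ha hb f f' g

theorem add_mul_weightedExp_mixStrategy_right (A : I → J → ℝ) {θ : ℕ → ℝ} (hθ : Summable θ)
    {a b : ℝ} (ha : 0 ≤ a) (hb : 0 ≤ b) (f : List (Outcome I J) → stdSimplex ℝ I)
    (g g' : List (Outcome I J) → stdSimplex ℝ J) :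
    (a + b) * weightedExp A θ f (mixStrategy Outcome.j a b g g') =
      a * weightedExp A θ f g + b * weightedExp A θ f g' := by
  simp only [weightedExp, ← tsum_mul_left]
  rw [← ((summable_mul_stageExp A hθ f g).mul_left a).tsum_add
    ((summable_mul_stageExp A hθ f g').mul_left b)]
  refine tsum_congr fun m => ?_
  linear_combination θ m * add_mul_stageExp_mixStrategy_right A m ha hb f g g'

end Weighted

/-! ### A minmax theorem -/

open scoped Pointwise in
/-- If each `t` gives more than `c` at one of finitely many rows, then a single convex combination
of the rows gets at least `c` against every `t`. -/
theorem exists_weights_of_exists_lt {N T : Type*} [Fintype N] [Nonempty T] (u : N → T → ℝ)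
    (hT : Convex ℝ (Set.range fun t n => u n t)) {c : ℝ} (hc : ∀ t, ∃ n, c < u n t) :
    ∃ w ∈ stdSimplex ℝ N, ∀ t, c ≤ ∑ n, w n * u n t := by
  classical
  have hopen : IsOpen {d : N → ℝ | ∀ n, d n < c} := by
    simp only [Set.ofPred_forall]
    exact isOpen_iInter_of_finite fun n => isOpen_lt (continuous_apply n) continuous_const
  have hconv : Convex ℝ {d : N → ℝ | ∀ n, d n < c} := by
    simp only [Set.ofPred_forall]
    exact convex_iInter fun n =>
      convex_halfSpace_lt (LinearMap.proj (R := ℝ) (φ := fun _ : N => ℝ) n).isLinear c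
  have hD : Convex ℝ ((Set.range fun t n => u n t) + Set.Ici (0 : N → ℝ)) :=
    hT.add (convex_Ici 0)
  obtain ⟨φ, r, h1, h2⟩ := geometric_hahn_banach_open hconv hopen hD (by
    rw [Set.disjoint_left]
    rintro d hd ⟨_, ⟨t, rfl⟩, e, he, rfl⟩
    obtain ⟨n, hn⟩ := hc t
    have := hd n
    have h0 : 0 ≤ e n := he n
    simp only [Pi.add_apply] at this
    linarith)
  set w : N → ℝ := fun n => φ (Pi.single n 1) with hw
  have hφ : ∀ d, φ d = ∑ n, w n * d n := by
    intro d
    conv_lhs => rw [← Finset.univ_sum_single d, map_sum]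
    refine Finset.sum_congr rfl fun n _ => ?_
    have : (Pi.single n (d n) : N → ℝ) = d n • Pi.single n 1 := by
      rw [← Pi.single_smul, smul_eq_mul, mul_one]
    rw [this, map_smul, smul_eq_mul, mul_comm]
  obtain ⟨t₀⟩ := ‹Nonempty T›
  have hw0 : ∀ n, 0 ≤ w n := by
    intro n
    by_contra! hneg
    -- moving up in the coordinate `n` by `s` would make `φ` drop below `r`
    set v := φ (fun n => u n t₀) with hv
    have hs : 0 ≤ (|v - r| + 1) / (-w n) := div_nonneg (by positivity) (by linarith)
    have := h2 ((fun n => u n t₀) + Pi.single n ((|v - r| + 1) / (-w n)))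
      (Set.add_mem_add ⟨t₀, rfl⟩ (by
        intro m
        rcases eq_or_ne m n with rfl | hmn
        · simpa using hs
        · simp [hmn]))
    rw [map_add, hφ (Pi.single n _)] at this
    simp only [Pi.single_apply, mul_ite, mul_zero, Finset.sum_ite_eq', Finset.mem_univ,
      if_true] at this
    have h3 : w n * ((|v - r| + 1) / (-w n)) = -(|v - r| + 1) := by
      rw [div_neg, mul_neg, mul_div_cancel₀ _ hneg.ne]
    rw [h3] at this
    have := le_abs_self (v - r)
    linarith
  have hlt : ∀ ε > 0, (∑ n, w n) * (c - ε) < r := by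
    intro ε hε
    have := h1 (fun _ => c - ε) (fun n => by simp only; linarith)
    rwa [hφ, ← Finset.sum_mul] at this
  have hge : ∀ t, r ≤ ∑ n, w n * u n t := by
    intro t
    rw [← hφ]
    have := h2 ((fun n => u n t) + 0) (Set.add_mem_add ⟨t, rfl⟩ Set.self_mem_Ici)
    rwa [add_zero] at this
  have hS0 : 0 ≤ ∑ n, w n := Finset.sum_nonneg fun n _ => hw0 n
  have hS : 0 < ∑ n, w n := by
    rcases hS0.lt_or_eq with h | h
    · exact h
    · exfalso
      have h3 := hlt 1 one_pos
      have h4 := hge t₀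
      have h5 : ∀ n, w n = 0 := fun n =>
        (Finset.sum_eq_zero_iff_of_nonneg fun n _ => hw0 n).1 h.symm n (Finset.mem_univ n)
      simp [h5] at h3 h4
      linarith
  refine ⟨fun n => w n / ∑ n, w n, ⟨fun n => div_nonneg (hw0 n) hS0, ?_⟩, fun t => ?_⟩
  · rw [← Finset.sum_div, div_self hS.ne']
  · simp only [div_mul_eq_mul_div]
    rw [← Finset.sum_div, le_div_iff₀ hS, mul_comm]
    refine le_of_forall_pos_lt_add fun δ hδ => ?_
    have h3 := hlt (δ / ∑ n, w n) (div_pos hδ hS)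
    rw [mul_sub, mul_div_cancel₀ _ hS.ne'] at h3
    linarith [hge t]

/-- A minmax theorem for a continuous payoff on a product of compact spaces. Mixing is expressed by
the convexity of the sets of payoff functions, so that no linear structure is needed on `S`, `T`. -/
theorem iSup_iInf_eq_iInf_iSup {S T : Type*} [TopologicalSpace S] [CompactSpace S] [Nonempty S]
    [TopologicalSpace T] [CompactSpace T] [Nonempty T] (u : S → T → ℝ)
    (hu : Continuous (Function.uncurry u)) (hS : Convex ℝ (Set.range u))
    (hT : Convex ℝ (Set.range fun t s => u s t)) :
    ⨆ s, ⨅ t, u s t = ⨅ t, ⨆ s, u s t := by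
  have hs : ∀ s, Continuous (u s) := fun s => hu.comp (Continuous.prodMk_right s)
  obtain ⟨M, hM⟩ := (isCompact_range hu).bddAbove
  obtain ⟨m, hm⟩ := (isCompact_range hu).bddBelow
  have hM : ∀ s t, u s t ≤ M := fun s t => hM ⟨(s, t), rfl⟩
  have hm : ∀ s t, m ≤ u s t := fun s t => hm ⟨(s, t), rfl⟩
  have ht : ∀ t, BddAbove (Set.range fun s => u s t) := fun t =>
    ⟨M, by rintro _ ⟨s, rfl⟩; exact hM s t⟩
  have hs' : ∀ s, BddBelow (Set.range fun t => u s t) := fun s =>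
    ⟨m, by rintro _ ⟨t, rfl⟩; exact hm s t⟩
  obtain ⟨s₀⟩ := ‹Nonempty S›
  obtain ⟨t₀⟩ := ‹Nonempty T›
  have hinfle : ∀ s, ⨅ t, u s t ≤ M := fun s => (ciInf_le (hs' s) t₀).trans (hM s t₀)
  have hlesup : ∀ t, m ≤ ⨆ s, u s t := fun t => (hm s₀ t).trans (le_ciSup (ht t) s₀)
  have : Nonempty S := ⟨s₀⟩
  have : Nonempty T := ⟨t₀⟩
  apply le_antisymm
  · exact ciSup_le fun s => le_ciInf fun t => (ciInf_le (hs' s) t).trans (le_ciSup (ht t) s)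
  by_contra! hlt
  -- by compactness, finitely many `s` suffice to get more than `c` against each `t`
  obtain ⟨c, hc1, hc2⟩ := exists_between hlt
  have hcov : ∀ t, ∃ s, c < u s t := fun t =>
    exists_lt_of_lt_ciSup (hc2.trans_le (ciInf_le ⟨m, by rintro _ ⟨t, rfl⟩; exact hlesup t⟩ t))
  obtain ⟨F, hF⟩ := isCompact_univ.elim_finite_subcover (fun s => {t | c < u s t})
    (fun s => isOpen_lt continuous_const (hs s))
    (fun t _ => Set.mem_iUnion.2 (hcov t))
  obtain ⟨w, hw, hwt⟩ := exists_weights_of_exists_lt (fun (n : F) t => u n t)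
    (c := c) (by
      have := hT.linear_image (LinearMap.funLeft ℝ ℝ (fun n : F => (n : S)))
      rwa [← Set.range_comp] at this)
    (fun t => by
      obtain ⟨s, hsF, hst⟩ : ∃ s ∈ F, c < u s t := by simpa using hF (Set.mem_univ t)
      exact ⟨⟨s, hsF⟩, hst⟩)
  obtain ⟨s, hs1⟩ : ∑ n : F, w n • u n ∈ Set.range u :=
    hS.sum_mem (fun n _ => hw.1 n) hw.2 fun n _ => ⟨n, rfl⟩
  have : c ≤ ⨅ t, u s t := le_ciInf fun t => by
    rw [hs1]
    simpa using hwt t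
  exact absurd (this.trans (le_ciSup ⟨M, by rintro _ ⟨s, rfl⟩; exact hinfle s⟩ s)) (not_le.2 hc1)

/-! ### Payoffs given the type of player 1 -/

section Types

variable {K L I J : Type*} [Fintype L] [Fintype I] [Fintype J]

/-- The expected payoff of the type `k` of player 1 when this type uses `f` against `t`. -/
def typePayoff (G : K → L → I → J → ℝ) (Q : K → stdSimplex ℝ L) (ζ : K → ℝ) (θ : ℕ → ℝ) (k : K)
    (f : List (Outcome I J) → stdSimplex ℝ I) (t : Strategy L I J J) : ℝ :=
  ζ k * ∑ l, Q k l * weightedExp (G k l) θ f (t l)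

/-- The best payoff that the type `k` of player 1 can get against `t`. -/
def bestPayoff (G : K → L → I → J → ℝ) (Q : K → stdSimplex ℝ L) (ζ : K → ℝ) (θ : ℕ → ℝ) (k : K)
    (t : Strategy L I J J) : ℝ :=
  ⨆ f : List (Outcome I J) → stdSimplex ℝ I, typePayoff G Q ζ θ k f t

variable (G : K → L → I → J → ℝ) (Q : K → stdSimplex ℝ L) (ζ : K → ℝ) {θ : ℕ → ℝ}

theorem payoff_prodCond [Fintype K] (p : stdSimplex ℝ K) (hθ : Summable θ) (s : Strategy K I J I)
    (t : Strategy L I J J) :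
    payoff G (prodCond p Q) ζ θ s t = ∑ k, p k * typePayoff G Q ζ θ k (s k) t := by
  refine Finset.sum_congr rfl fun k _ => ?_
  rw [typePayoff, Finset.mul_sum, Finset.mul_sum]
  refine Finset.sum_congr rfl fun l _ => ?_
  rw [integral_weighted (G k l) hθ]
  have : prodCond p Q (k, l) = p k * Q k l := rfl
  rw [this]
  ring

theorem dualPayoff_eq [Fintype K] (x : K → ℝ) (p : stdSimplex ℝ K) (hθ : Summable θ)
    (s : Strategy K I J I)
    (t : Strategy L I J J) :
    dualPayoff G x Q ζ θ p s t = ∑ k, p k * (typePayoff G Q ζ θ k (s k) t - x k) := by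
  simp only [dualPayoff, payoff_prodCond G Q ζ p hθ, mul_sub, Finset.sum_sub_distrib]

theorem continuous_typePayoff {X : Type*} [TopologicalSpace X] (hθ : Summable θ) (k : K)
    {f : X → List (Outcome I J) → stdSimplex ℝ I} {t : X → Strategy L I J J} (hf : Continuous f)
    (ht : Continuous t) : Continuous fun x => typePayoff G Q ζ θ k (f x) (t x) :=
  continuous_const.mul <| continuous_finsetSum _ fun l _ => continuous_const.mul <|
    continuous_weightedExp (G k l) hθ hf ((continuous_apply l).comp ht)

theorem continuous_payoff [Fintype K] {X : Type*} [TopologicalSpace X] (hθ : Summable θ)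
    {p : X → stdSimplex ℝ K} {s : X → Strategy K I J I} {t : X → Strategy L I J J}
    (hp : Continuous p) (hs : Continuous s) (ht : Continuous t) :
    Continuous fun x => payoff G (prodCond (p x) Q) ζ θ (s x) (t x) := by
  simp only [payoff_prodCond G Q ζ _ hθ]
  exact continuous_finsetSum _ fun k _ => ((continuous_stdSimplex_apply k).comp hp).mul <|
    continuous_typePayoff G Q ζ hθ k ((continuous_apply k).comp hs) ht

theorem continuous_dualPayoff [Fintype K] {X : Type*} [TopologicalSpace X] (x : K → ℝ)
    (hθ : Summable θ)
    {p : X → stdSimplex ℝ K} {s : X → Strategy K I J I} {t : X → Strategy L I J J}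
    (hp : Continuous p) (hs : Continuous s) (ht : Continuous t) :
    Continuous fun z => dualPayoff G x Q ζ θ (p z) (s z) (t z) :=
  (continuous_payoff G Q ζ hθ hp hs ht).sub <| continuous_finsetSum _ fun k _ =>
    ((continuous_stdSimplex_apply k).comp hp).mul continuous_const

theorem add_mul_typePayoff_mixStrategy_left (hθ : Summable θ) (k : K) {a b : ℝ} (ha : 0 ≤ a)
    (hb : 0 ≤ b) (f f' : List (Outcome I J) → stdSimplex ℝ I) (t : Strategy L I J J) :
    (a + b) * typePayoff G Q ζ θ k (mixStrategy Outcome.i a b f f') t =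
      a * typePayoff G Q ζ θ k f t + b * typePayoff G Q ζ θ k f' t := by
  simp only [typePayoff, Finset.mul_sum, ← Finset.sum_add_distrib]
  refine Finset.sum_congr rfl fun l _ => ?_
  linear_combination ζ k * Q k l *
    add_mul_weightedExp_mixStrategy_left (G k l) hθ ha hb f f' (t l)

theorem add_mul_typePayoff_mixStrategy_right (hθ : Summable θ) (k : K) {a b : ℝ} (ha : 0 ≤ a)
    (hb : 0 ≤ b) (f : List (Outcome I J) → stdSimplex ℝ I) (t t' : Strategy L I J J) :
    (a + b) * typePayoff G Q ζ θ k f (fun l => mixStrategy Outcome.j a b (t l) (t' l)) =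
      a * typePayoff G Q ζ θ k f t + b * typePayoff G Q ζ θ k f t' := by
  simp only [typePayoff, Finset.mul_sum, ← Finset.sum_add_distrib]
  refine Finset.sum_congr rfl fun l _ => ?_
  linear_combination ζ k * Q k l *
    add_mul_weightedExp_mixStrategy_right (G k l) hθ ha hb f (t l) (t' l)

theorem abs_typePayoff_le {C : ℝ} (hG : ∀ k l i j, |G k l i j| ≤ C) (hθ : IsEvaluation θ) (k : K)
    (f : List (Outcome I J) → stdSimplex ℝ I) (t : Strategy L I J J) :
    |typePayoff G Q ζ θ k f t| ≤ C * |ζ k| := by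
  rw [typePayoff, abs_mul, mul_comm]
  refine mul_le_mul_of_nonneg_right ?_ (abs_nonneg _)
  calc |∑ l, Q k l * weightedExp (G k l) θ f (t l)| ≤ ∑ l, Q k l * C := by
        refine (Finset.abs_sum_le_sum_abs _ _).trans (Finset.sum_le_sum fun l _ => ?_)
        rw [abs_mul, abs_of_nonneg (stdSimplex.zero_le (Q k) l)]
        exact mul_le_mul_of_nonneg_left (abs_weightedExp_le (hG k l) hθ _ _)
          (stdSimplex.zero_le (Q k) l)
    _ = C := by rw [← Finset.sum_mul, stdSimplex.sum_eq_one, one_mul]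

theorem typePayoff_le_bestPayoff (hθ : Summable θ) (k : K)
    (f : List (Outcome I J) → stdSimplex ℝ I) (t : Strategy L I J J) :
    typePayoff G Q ζ θ k f t ≤ bestPayoff G Q ζ θ k t :=
  le_ciSup (isCompact_range
    (continuous_typePayoff G Q ζ hθ k continuous_id (continuous_const (y := t)))).bddAbove f

theorem exists_typePayoff_eq_bestPayoff [Nonempty I] (hθ : Summable θ) (k : K)
    (t : Strategy L I J J) : ∃ f, typePayoff G Q ζ θ k f t = bestPayoff G Q ζ θ k t := by
  obtain ⟨f, -, hf⟩ := isCompact_univ.exists_isMaxOn Set.univ_nonempty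
    (continuous_typePayoff G Q ζ hθ k continuous_id (continuous_const (y := t))).continuousOn
  exact ⟨f, (typePayoff_le_bestPayoff G Q ζ hθ k f t).antisymm
    (ciSup_le fun f' => hf (Set.mem_univ f'))⟩

/-! ### Existence of the values -/

theorem primalMaxmin_prodCond_eq [Fintype K] [Nonempty I] [Nonempty J] (p : stdSimplex ℝ K)
    (hθ : Summable θ) :
    primalMaxmin G (prodCond p Q) ζ θ = primalMinmax G (prodCond p Q) ζ θ := by
  refine iSup_iInf_eq_iInf_iSup _
    (continuous_payoff G Q ζ hθ continuous_const continuous_fst continuous_snd) ?_ ?_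
  · rintro _ ⟨s, rfl⟩ _ ⟨s', rfl⟩ a b ha hb hab
    refine ⟨fun k => mixStrategy Outcome.i a b (s k) (s' k), funext fun t => ?_⟩
    simp only [payoff_prodCond G Q ζ p hθ, Pi.add_apply, Pi.smul_apply, smul_eq_mul,
      Finset.mul_sum, ← Finset.sum_add_distrib]
    refine Finset.sum_congr rfl fun k _ => ?_
    have := add_mul_typePayoff_mixStrategy_left G Q ζ hθ k ha hb (s k) (s' k) t
    rw [hab, one_mul] at this
    rw [this]
    ring
  · rintro _ ⟨t, rfl⟩ _ ⟨t', rfl⟩ a b ha hb hab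
    refine ⟨fun l => mixStrategy Outcome.j a b (t l) (t' l), funext fun s => ?_⟩
    simp only [payoff_prodCond G Q ζ p hθ, Pi.add_apply, Pi.smul_apply, smul_eq_mul,
      Finset.mul_sum, ← Finset.sum_add_distrib]
    refine Finset.sum_congr rfl fun k _ => ?_
    have := add_mul_typePayoff_mixStrategy_right G Q ζ hθ k ha hb (s k) t t'
    rw [hab, one_mul] at this
    rw [this]
    ring

theorem dualMaxmin_eq [Fintype K] [Nonempty K] [Nonempty I] [Nonempty J] (x : K → ℝ)
    (hθ : Summable θ) :
    dualMaxmin G x Q ζ θ = dualMinmax G x Q ζ θ := by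
  refine iSup_iInf_eq_iInf_iSup
    (fun (ps : stdSimplex ℝ K × Strategy K I J I) t => dualPayoff G x Q ζ θ ps.1 ps.2 t)
    (continuous_dualPayoff G Q ζ x hθ (continuous_fst.comp continuous_fst)
      (continuous_snd.comp continuous_fst) continuous_snd) ?_ ?_
  · rintro _ ⟨⟨p, s⟩, rfl⟩ _ ⟨⟨p', s'⟩, rfl⟩ a b ha hb hab
    -- the type `k` mixes `s k` and `s' k` with the posterior weights `a p(k)` and `b p'(k)`
    refine ⟨(mixAction a b p p', fun k => mixStrategy Outcome.i (a * p k) (b * p' k) (s k) (s' k)),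
      funext fun t => ?_⟩
    simp only [dualPayoff_eq G Q ζ x _ hθ, Pi.add_apply, Pi.smul_apply, smul_eq_mul,
      Finset.mul_sum, ← Finset.sum_add_distrib]
    refine Finset.sum_congr rfl fun k _ => ?_
    have h1 := add_mul_typePayoff_mixStrategy_left G Q ζ hθ k
      (mul_nonneg ha (stdSimplex.zero_le p k)) (mul_nonneg hb (stdSimplex.zero_le p' k))
      (s k) (s' k) t
    have h2 := add_mul_mixAction ha hb p p' k
    rw [hab, one_mul] at h2
    rw [h2]
    linear_combination h1
  · rintro _ ⟨t, rfl⟩ _ ⟨t', rfl⟩ a b ha hb hab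
    refine ⟨fun l => mixStrategy Outcome.j a b (t l) (t' l), funext fun ps => ?_⟩
    simp only [dualPayoff_eq G Q ζ x _ hθ, Pi.add_apply, Pi.smul_apply, smul_eq_mul,
      Finset.mul_sum, ← Finset.sum_add_distrib]
    refine Finset.sum_congr rfl fun k _ => ?_
    have := add_mul_typePayoff_mixStrategy_right G Q ζ hθ k ha hb (ps.2 k) t t'
    rw [hab, one_mul] at this
    rw [this]
    linear_combination ps.1 k * x k * hab

/-- Every joint law is a marginal law followed by a conditional law. -/
theorem exists_eq_prodCond [Fintype K] [Nonempty L] (π : stdSimplex ℝ (K × L)) :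
    ∃ (p : stdSimplex ℝ K) (Q : K → stdSimplex ℝ L), π = prodCond p Q := by
  have h0 : ∀ k l, 0 ≤ π (k, l) := fun k l => stdSimplex.zero_le π (k, l)
  have hQ : ∀ k, ∃ q : stdSimplex ℝ L, ∀ l, π (k, l) = (∑ l, π (k, l)) * q l := by
    intro k
    by_cases h : ∑ l, π (k, l) = 0
    · obtain ⟨q⟩ : Nonempty (stdSimplex ℝ L) := inferInstance
      refine ⟨q, fun l => ?_⟩
      rw [h, zero_mul]
      exact (Finset.sum_eq_zero_iff_of_nonneg fun l _ => h0 k l).1 h l (Finset.mem_univ l)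
    · refine ⟨⟨fun l => π (k, l) / ∑ l, π (k, l),
        fun l => div_nonneg (h0 k l) (Finset.sum_nonneg fun l _ => h0 k l), ?_⟩, fun l => ?_⟩
      · rw [← Finset.sum_div]
        exact div_self h
      · exact (mul_div_cancel₀ _ h).symm
  choose Q hQ using hQ
  refine ⟨⟨fun k => ∑ l, π (k, l), fun k => Finset.sum_nonneg fun l _ => h0 k l, ?_⟩, Q, ?_⟩
  · rw [← Fintype.sum_prod_type' fun k l => π (k, l)]
    exact stdSimplex.sum_eq_one π
  · exact stdSimplex.ext (funext fun kl => hQ kl.1 kl.2)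

end Types

/-! ### The updates after one stage -/

section Evaluations

theorem IsEvaluation.apply_zero_le_one {θ : ℕ → ℝ} (hθ : IsEvaluation θ) : θ 0 ≤ 1 :=
  le_hasSum hθ.2 0 fun m _ => hθ.1 m

theorem IsEvaluation.hasSum_succ {θ : ℕ → ℝ} (hθ : IsEvaluation θ) :
    HasSum (fun m => θ (m + 1)) (1 - θ 0) := by
  simpa using (hasSum_nat_add_iff' 1).2 hθ.2

theorem IsEvaluation.shift {θ : ℕ → ℝ} (hθ : IsEvaluation θ) (h : θ 0 < 1) :
    IsEvaluation (shift θ) := by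
  have h1 : 0 < 1 - θ 0 := by linarith
  refine ⟨fun m => div_nonneg (hθ.1 _) h1.le, ?_⟩
  have := hθ.hasSum_succ.div_const (1 - θ 0)
  rwa [div_self h1.ne'] at this

theorem IsEvaluation.summable_shift {θ : ℕ → ℝ} (hθ : IsEvaluation θ) :
    Summable (RepeatedGame.shift θ) :=
  hθ.hasSum_succ.summable.div_const _

/-- This also holds when the first stage has the whole weight: both sides are then `0`. -/
theorem IsEvaluation.mul_shift {θ : ℕ → ℝ} (hθ : IsEvaluation θ) (m : ℕ) :
    (1 - θ 0) * RepeatedGame.shift θ m = θ (m + 1) := by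
  rcases eq_or_ne (1 - θ 0) 0 with h | h
  · have h1 : θ (m + 1) ≤ 1 - θ 0 := le_hasSum hθ.hasSum_succ m fun m _ => hθ.1 _
    rw [h, zero_mul]
    exact le_antisymm (hθ.1 _) (h ▸ h1)
  · exact mul_div_cancel₀ _ h

end Evaluations

section FirstStage

variable {L I J : Type*} [Fintype J]

/-- The mixed actions prescribed by `t` at the first stage. -/
def firstAction (t : Strategy L I J J) : L → stdSimplex ℝ J := fun l => t l []

/-- The strategy prescribed by `t` once the actions `i`, `j` have been played at the first stage. -/
def continuation (t : Strategy L I J J) (i : I) (j : J) : Strategy L I J J :=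
  fun l h => t l (⟨i, j⟩ :: h)

theorem isClosed_setOf_firstAction_eq (τ : L → stdSimplex ℝ J) :
    IsClosed {t : Strategy L I J J | firstAction t = τ} :=
  isClosed_eq (continuous_pi fun l => (continuous_apply []).comp (continuous_apply l))
    continuous_const

end FirstStage

/-! ### Bellman's equation of a type of player 1 -/

section Bellman

variable {K L I J : Type*} [Fintype L] [Fintype I] [Fintype J]
variable (G : K → L → I → J → ℝ) (Q : K → stdSimplex ℝ L) (ζ : K → ℝ) {θ : ℕ → ℝ}

theorem actionProb_nonneg (τ : L → stdSimplex ℝ J) (j : J) (k : K) : 0 ≤ actionProb Q τ j k :=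
  Finset.sum_nonneg fun l _ => mul_nonneg (stdSimplex.zero_le _ l) (stdSimplex.zero_le _ j)

theorem sum_actionProb (τ : L → stdSimplex ℝ J) (k : K) : ∑ j, actionProb Q τ j k = 1 := by
  simp only [actionProb]
  rw [Finset.sum_comm]
  simp [← Finset.mul_sum, stdSimplex.sum_eq_one]

theorem actionProb_mul_updateQ (τ : L → stdSimplex ℝ J) (j : J) (k : K) (l : L) :
    actionProb Q τ j k * updateQ Q τ j k l = Q k l * τ l j := by
  by_cases h : actionProb Q τ j k = 0
  · rw [h, zero_mul]
    exact ((Finset.sum_eq_zero_iff_of_nonneg fun l _ => mul_nonneg (stdSimplex.zero_le _ l)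
      (stdSimplex.zero_le _ j)).1 h l (Finset.mem_univ l)).symm
  · have : updateQ Q τ j k l = Q k l * τ l j / actionProb Q τ j k := by
      rw [updateQ, dif_neg h]; rfl
    rw [this, mul_div_cancel₀ _ h]

theorem sum_abs_updateWeight (τ : L → stdSimplex ℝ J) (k : K) :
    ∑ j, |updateWeight Q ζ τ j k| = |ζ k| := by
  simp only [updateWeight, abs_mul, abs_of_nonneg (actionProb_nonneg Q τ _ k)]
  rw [← Finset.mul_sum, sum_actionProb, mul_one]

theorem typePayoff_eq (hθ : IsEvaluation θ) (k : K) (f : List (Outcome I J) → stdSimplex ℝ I)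
    (t : Strategy L I J J) :
    typePayoff G Q ζ θ k f t = ∑ i, f [] i * (θ 0 * stagePayoff G Q ζ (firstAction t) i k +
      (1 - θ 0) * ∑ j, typePayoff G (updateQ Q (firstAction t) j)
        (updateWeight Q ζ (firstAction t) j) (shift θ) k (fun h => f (⟨i, j⟩ :: h))
        (continuation t i j)) := by
  have hθ' : (fun m => θ (m + 1)) = fun m => (1 - θ 0) * shift θ m :=
    funext fun m => (hθ.mul_shift m).symm
  simp only [typePayoff, weightedExp_eq _ hθ.2.summable f, hθ', weightedExp_const_mul, stagePayoff,
    Finset.mul_sum]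
  rw [Finset.sum_comm]
  refine Finset.sum_congr rfl fun i _ => ?_
  simp only [mul_add, Finset.mul_sum]
  rw [Finset.sum_comm (s := (Finset.univ : Finset J)), ← Finset.sum_add_distrib]
  refine Finset.sum_congr rfl fun l _ => ?_
  rw [← Finset.sum_add_distrib]
  refine Finset.sum_congr rfl fun j _ => ?_
  have h := actionProb_mul_updateQ Q (firstAction t) j k l
  simp only [updateWeight]
  have h1 : firstAction t l j = t l [] j := rfl
  have h2 : continuation t i j l = fun h => t l (⟨i, j⟩ :: h) := rfl
  rw [h1] at h ⊢
  rw [h2]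
  linear_combination -(f [] i * (1 - θ 0) * ζ k *
    weightedExp (G k l) (shift θ) (fun h => f (⟨i, j⟩ :: h)) (fun h => t l (⟨i, j⟩ :: h))) * h

/-- Bellman's equation for the type `k` of player 1: its best payoff is the maximum over its first
action `i` of the payoff obtained by playing `i` and then optimally. -/
theorem bestPayoff_le_iff [Nonempty I] (hθ : IsEvaluation θ) (k : K) (t : Strategy L I J J)
    (c : ℝ) :
    bestPayoff G Q ζ θ k t ≤ c ↔ ∀ i, θ 0 * stagePayoff G Q ζ (firstAction t) i k +
      (1 - θ 0) * ∑ j, bestPayoff G (updateQ Q (firstAction t) j)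
        (updateWeight Q ζ (firstAction t) j) (shift θ) k (continuation t i j) ≤ c := by
  classical
  constructor
  · intro h i
    choose f hf using fun j => exists_typePayoff_eq_bestPayoff G (updateQ Q (firstAction t) j)
      (updateWeight Q ζ (firstAction t) j) hθ.summable_shift k (continuation t i j)
    -- play `i` and then a best reply to the continuation of `t`
    let f' : List (Outcome I J) → stdSimplex ℝ I
      | [] => ⟨Pi.single i 1, single_mem_stdSimplex ℝ i⟩
      | o :: h => f o.j h
    have h1 := (typePayoff_le_bestPayoff G Q ζ hθ.2.summable k f' t).trans h
    rw [typePayoff_eq G Q ζ hθ] at h1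
    have h2 : ∀ i', f' [] i' = (Pi.single i 1 : I → ℝ) i' := fun i' => rfl
    simp only [h2, Pi.single_apply, ite_mul, one_mul, zero_mul, Finset.sum_ite_eq',
      Finset.mem_univ, if_true] at h1
    simp only [← hf]
    exact h1
  · intro h
    refine ciSup_le fun f => ?_
    rw [typePayoff_eq G Q ζ hθ]
    have h1 : 0 ≤ 1 - θ 0 := by linarith [hθ.apply_zero_le_one]
    calc _ ≤ ∑ i, f [] i * c := by
          refine Finset.sum_le_sum fun i _ =>
            mul_le_mul_of_nonneg_left (le_trans ?_ (h i)) (stdSimplex.zero_le _ i)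
          gcongr with j
          exact typePayoff_le_bestPayoff _ _ _ hθ.summable_shift _ _ _
      _ = c := by rw [← Finset.sum_mul, stdSimplex.sum_eq_one, one_mul]

/-- If the continuations of `t` guarantee `y i j k + W i j k` to each type `k`, where the vectors
`y i j` split `x` as in the recursive formula, then `t` guarantees the corresponding average. -/
theorem bestPayoff_le_of_continuation [Nonempty I] (x : K → ℝ) (hθ : IsEvaluation θ) (h1 : θ 0 < 1)
    {t : Strategy L I J J} {y : I → J → K → ℝ}
    (hy : y ∈ splittings G x Q ζ θ (firstAction t)) {k : K} {W : I → J → ℝ} {c : ℝ}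
    (hW : ∀ i j, bestPayoff G (updateQ Q (firstAction t) j) (updateWeight Q ζ (firstAction t) j)
      (shift θ) k (continuation t i j) ≤ y i j k + W i j)
    (hc : ∀ i, (1 - θ 0) * ∑ j, W i j ≤ c) :
    bestPayoff G Q ζ θ k t ≤ x k + c := by
  rw [bestPayoff_le_iff G Q ζ hθ]
  intro i
  have h2 : 0 < 1 - θ 0 := by linarith
  have h3 := hy i k
  rw [eq_div_iff h2.ne'] at h3
  have h4 := mul_le_mul_of_nonneg_left 
    (Finset.sum_le_sum fun j (_ : j ∈ Finset.univ) => hW i j) h2.le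
  rw [Finset.sum_add_distrib] at h4
  have := hc i
  nlinarith

end Bellman

/-! ### The dual game -/

section Dual

variable {K L I J : Type*} [Fintype K] [Fintype L] [Fintype I] [Fintype J]

/-- The largest payoff that player 1 can get against `t` in the dual game. -/
def dualGuarantee (G : K → L → I → J → ℝ) (x : K → ℝ) (Q : K → stdSimplex ℝ L) (ζ : K → ℝ)
    (θ : ℕ → ℝ) (t : Strategy L I J J) : ℝ :=
  ⨆ k, (bestPayoff G Q ζ θ k t - x k)

theorem continuationMax_le_iff [Nonempty I] (G : K → L → I → J → ℝ) (Q : K → stdSimplex ℝ L)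
    (ζ : K → ℝ) (θ : ℕ → ℝ) (τ : L → stdSimplex ℝ J) (y : I → J → K → ℝ) (c : ℝ) :
    continuationMax G Q ζ θ τ y ≤ c ↔ ∀ i, ∑ j, dualMinmax G (y i j) (updateQ Q τ j)
      (updateWeight Q ζ τ j) (shift θ) ≤ c :=
  ciSup_le_iff (Set.finite_range _).bddAbove

variable (G : K → L → I → J → ℝ) (x : K → ℝ) (Q : K → stdSimplex ℝ L) (ζ : K → ℝ) {θ : ℕ → ℝ}

theorem dualGuarantee_le_iff [Nonempty K] (t : Strategy L I J J) (c : ℝ) :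
    dualGuarantee G x Q ζ θ t ≤ c ↔ ∀ k, bestPayoff G Q ζ θ k t ≤ x k + c := by
  rw [dualGuarantee, ciSup_le_iff (Set.finite_range _).bddAbove]
  simp only [sub_le_iff_le_add']

theorem dualPayoff_le_dualGuarantee [Nonempty K] (hθ : Summable θ) (p : stdSimplex ℝ K)
    (s : Strategy K I J I) (t : Strategy L I J J) :
    dualPayoff G x Q ζ θ p s t ≤ dualGuarantee G x Q ζ θ t := by
  rw [dualPayoff_eq G Q ζ x p hθ]
  calc _ ≤ ∑ k, p k * dualGuarantee G x Q ζ θ t := by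
        refine Finset.sum_le_sum fun k _ => mul_le_mul_of_nonneg_left ?_ (stdSimplex.zero_le p k)
        have := (dualGuarantee_le_iff G x Q ζ (θ := θ) t _).1 le_rfl k
        linarith [typePayoff_le_bestPayoff G Q ζ hθ k (s k) t]
    _ = _ := by rw [← Finset.sum_mul, stdSimplex.sum_eq_one, one_mul]

theorem bddAbove_dualPayoff [Nonempty K] (hθ : Summable θ) (t : Strategy L I J J) :
    BddAbove (Set.range fun ps : stdSimplex ℝ K × Strategy K I J I =>
      dualPayoff G x Q ζ θ ps.1 ps.2 t) :=
  ⟨dualGuarantee G x Q ζ θ t, by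
    rintro _ ⟨ps, rfl⟩; exact dualPayoff_le_dualGuarantee G x Q ζ hθ _ _ _⟩

theorem iSup_dualPayoff [Nonempty K] [Nonempty I] (hθ : Summable θ) (t : Strategy L I J J) :
    ⨆ ps : stdSimplex ℝ K × Strategy K I J I, dualPayoff G x Q ζ θ ps.1 ps.2 t =
      dualGuarantee G x Q ζ θ t := by
  classical
  refine le_antisymm (ciSup_le fun ps => dualPayoff_le_dualGuarantee G x Q ζ hθ _ _ _) ?_
  rw [dualGuarantee_le_iff]
  intro k
  choose s hs using fun k => exists_typePayoff_eq_bestPayoff G Q ζ hθ k t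
  have h := le_ciSup (bddAbove_dualPayoff G x Q ζ hθ t)
    (⟨Pi.single k 1, single_mem_stdSimplex ℝ k⟩, s)
  have h1 : ∀ k', (⟨Pi.single k 1, single_mem_stdSimplex ℝ k⟩ : stdSimplex ℝ K) k' =
    (Pi.single k 1 : K → ℝ) k' := fun k' => rfl
  simp only [dualPayoff_eq G Q ζ x _ hθ, h1, hs, Pi.single_apply, ite_mul, one_mul, zero_mul,
    Finset.sum_ite_eq', Finset.mem_univ, if_true] at h
  simp only [dualPayoff_eq G Q ζ x _ hθ]
  linarith

theorem dualMinmax_eq_iInf [Nonempty K] [Nonempty I] (hθ : Summable θ) :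
    dualMinmax G x Q ζ θ = ⨅ t : Strategy L I J J, dualGuarantee G x Q ζ θ t :=
  iInf_congr fun t => iSup_dualPayoff G x Q ζ hθ t

theorem lowerSemicontinuous_dualGuarantee [Nonempty K] [Nonempty I] (hθ : Summable θ) :
    LowerSemicontinuous fun t : Strategy L I J J => dualGuarantee G x Q ζ θ t := by
  simp only [← iSup_dualPayoff G x Q ζ hθ]
  exact lowerSemicontinuous_ciSup (bddAbove_dualPayoff G x Q ζ hθ) fun ps =>
    (continuous_dualPayoff G Q ζ x hθ continuous_const continuous_const
      continuous_id).lowerSemicontinuous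

theorem exists_isMinOn_dualGuarantee [Nonempty K] [Nonempty I] (hθ : Summable θ)
    {A : Set (Strategy L I J J)} (hA : IsClosed A) (hne : A.Nonempty) :
    ∃ t ∈ A, ∀ t' ∈ A, dualGuarantee G x Q ζ θ t ≤ dualGuarantee G x Q ζ θ t' :=
  (lowerSemicontinuous_dualGuarantee G x Q ζ hθ).lowerSemicontinuousOn A |>.exists_isMinOn hne
    hA.isCompact

theorem exists_dualGuarantee_eq [Nonempty K] [Nonempty I] [Nonempty J] (hθ : Summable θ) :
    ∃ t : Strategy L I J J, dualGuarantee G x Q ζ θ t = dualMinmax G x Q ζ θ := by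
  obtain ⟨t, -, ht⟩ := exists_isMinOn_dualGuarantee G x Q ζ hθ isClosed_univ
    (Set.univ_nonempty (α := Strategy L I J J))
  refine ⟨t, ?_⟩
  rw [dualMinmax_eq_iInf G x Q ζ hθ]
  exact le_antisymm (le_ciInf fun t' => ht t' (Set.mem_univ _))
    (ciInf_le ⟨_, by rintro _ ⟨t', rfl⟩; exact ht t' (Set.mem_univ _)⟩ t)

theorem dualMinmax_le [Nonempty K] [Nonempty I] [Nonempty J] (hθ : Summable θ)
    (t : Strategy L I J J) : dualMinmax G x Q ζ θ ≤ dualGuarantee G x Q ζ θ t := by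
  obtain ⟨t₀, -, ht⟩ := exists_isMinOn_dualGuarantee G x Q ζ hθ isClosed_univ
    (Set.univ_nonempty (α := Strategy L I J J))
  rw [dualMinmax_eq_iInf G x Q ζ hθ]
  exact ciInf_le ⟨_, by rintro _ ⟨t', rfl⟩; exact ht t' (Set.mem_univ _)⟩ t

/-! ### The recursive formula -/

/-- Gluing strategies that are optimal after the first stage. -/
theorem exists_dualGuarantee_le [Nonempty K] [Nonempty I] [Nonempty J] (hθ : IsEvaluation θ)
    (h1 : θ 0 < 1) (τ : L → stdSimplex ℝ J) {y : I → J → K → ℝ}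
    (hy : y ∈ splittings G x Q ζ θ τ) :
    ∃ t : Strategy L I J J, firstAction t = τ ∧
      dualGuarantee G x Q ζ θ t ≤ (1 - θ 0) * continuationMax G Q ζ θ τ y := by
  choose t ht using fun i j => exists_dualGuarantee_eq (I := I) G (y i j) (updateQ Q τ j)
    (updateWeight Q ζ τ j) hθ.summable_shift
  let t' : Strategy L I J J := fun l h => match h with
    | [] => τ l
    | o :: h => t o.i o.j l h
  refine ⟨t', rfl, ?_⟩
  rw [dualGuarantee_le_iff]
  intro k
  refine bestPayoff_le_of_continuation G Q ζ x hθ h1 (t := t') hy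
    (fun i j => (dualGuarantee_le_iff _ _ _ _ _ _).1 (ht i j).le k) fun i => ?_
  exact mul_le_mul_of_nonneg_left ((continuationMax_le_iff G Q ζ θ τ y _).1 le_rfl i)
    (by linarith)

/-- Conversely, the vectors guaranteed by the continuations of `t`, increased so as to split `x`,
bound the right-hand side of the recursive formula. -/
theorem exists_continuationMax_le [Nonempty K] [Nonempty I] [Nonempty J] (hθ : IsEvaluation θ)
    (h1 : θ 0 < 1) (t : Strategy L I J J) :
    ∃ y ∈ splittings G x Q ζ θ (firstAction t),
      (1 - θ 0) * continuationMax G Q ζ θ (firstAction t) y ≤ dualGuarantee G x Q ζ θ t := by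
  have h2 : 0 < 1 - θ 0 := by linarith
  have hJ : (0 : ℝ) < Fintype.card J := by exact_mod_cast Fintype.card_pos
  set τ := firstAction t with hτ
  set r := dualGuarantee G x Q ζ θ t with hr
  let b : I → J → K → ℝ := fun i j k => bestPayoff G (updateQ Q τ j) (updateWeight Q ζ τ j)
    (shift θ) k (continuation t i j)
  let slack : I → K → ℝ := fun i k =>
    (x k - θ 0 * stagePayoff G Q ζ τ i k) / (1 - θ 0) - ∑ j, b i j k
  have hslack : ∀ i k, -(r / (1 - θ 0)) ≤ slack i k := by
    intro i k
    have h3 := (bestPayoff_le_iff G Q ζ hθ k t _).1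
      ((dualGuarantee_le_iff G x Q ζ t r).1 le_rfl k) i
    have h4 : ∑ j, b i j k ≤ (x k + r - θ 0 * stagePayoff G Q ζ τ i k) / (1 - θ 0) := by
      rw [le_div_iff₀ h2, mul_comm]
      linarith
    have h5 : (x k + r - θ 0 * stagePayoff G Q ζ τ i k) / (1 - θ 0) =
        (x k - θ 0 * stagePayoff G Q ζ τ i k) / (1 - θ 0) + r / (1 - θ 0) := by ring
    simp only [slack]
    linarith
  refine ⟨fun i j k => b i j k + slack i k / Fintype.card J, fun i k => ?_, ?_⟩
  · rw [Finset.sum_add_distrib, Finset.sum_const, Finset.card_univ, nsmul_eq_mul,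
      mul_div_cancel₀ _ hJ.ne']
    simp only [slack]
    ring
  · rw [← le_div_iff₀' h2, continuationMax_le_iff]
    intro i
    calc _ ≤ ∑ j : J, r / (1 - θ 0) / Fintype.card J := by
          refine Finset.sum_le_sum fun j _ => (dualMinmax_le G _ _ _ hθ.summable_shift
            (continuation t i j)).trans ((dualGuarantee_le_iff _ _ _ _ _ _).2 fun k => ?_)
          have h3 := div_le_div_of_nonneg_right (hslack i k) hJ.le
          rw [neg_div] at h3
          change b i j k ≤ _
          linarith
      _ = r / (1 - θ 0) := by
          rw [Finset.sum_const, Finset.card_univ, nsmul_eq_mul, mul_div_cancel₀ _ hJ.ne']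

/-- The dual recursive formula, with attainment of both minima. -/
theorem exists_isLeast_continuationMax [Nonempty K] [Nonempty I] [Nonempty J]
    (hθ : IsEvaluation θ) (h1 : θ 0 < 1) :
    ∃ (inner : (L → stdSimplex ℝ J) → ℝ) (outer : ℝ),
      (∀ τ, IsLeast (continuationMax G Q ζ θ τ '' splittings G x Q ζ θ τ) (inner τ)) ∧
      IsLeast (Set.range inner) outer ∧
      dualMinmax G x Q ζ θ = (1 - θ 0) * outer := by
  have h2 : 0 < 1 - θ 0 := by linarith
  have hs := hθ.2.summable
  choose t ht hmin using fun τ : L → stdSimplex ℝ J => exists_isMinOn_dualGuarantee G x Q ζ hs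
    (isClosed_setOf_firstAction_eq (I := I) τ) ⟨fun l _ => τ l, rfl⟩
  have key : ∀ τ, ∀ y ∈ splittings G x Q ζ θ τ,
      dualGuarantee G x Q ζ θ (t τ) ≤ (1 - θ 0) * continuationMax G Q ζ θ τ y := by
    intro τ y hy
    obtain ⟨t', ht', hle⟩ := exists_dualGuarantee_le G x Q ζ hθ h1 τ hy
    exact (hmin τ t' ht').trans hle
  refine ⟨fun τ => dualGuarantee G x Q ζ θ (t τ) / (1 - θ 0), dualMinmax G x Q ζ θ / (1 - θ 0),
    fun τ => ⟨?_, ?_⟩, ⟨?_, ?_⟩, (mul_div_cancel₀ _ h2.ne').symm⟩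
  · obtain ⟨y, hy, hle⟩ := exists_continuationMax_le G x Q ζ hθ h1 (t τ)
    have ht' : firstAction (t τ) = τ := ht τ
    rw [ht'] at hy hle
    refine ⟨y, hy, ?_⟩
    rw [eq_div_iff h2.ne', mul_comm]
    exact hle.antisymm (key τ y hy)
  · rintro _ ⟨y, hy, rfl⟩
    rw [div_le_iff₀' h2]
    exact key τ y hy
  · obtain ⟨t₀, h₀⟩ := exists_dualGuarantee_eq (I := I) (J := J) G x Q ζ hs
    refine ⟨firstAction t₀, ?_⟩
    simp only
    rw [← h₀]
    exact congrArg (· / (1 - θ 0)) ((hmin _ t₀ rfl).antisymm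
      (h₀.le.trans (dualMinmax_le G x Q ζ hs _)))
  · rintro _ ⟨τ, rfl⟩
    exact div_le_div_of_nonneg_right (dualMinmax_le G x Q ζ hs _) h2.le

theorem dualGuarantee_eq_oneStageMax [Nonempty K] [Nonempty I] (hθ : IsEvaluation θ)
    (h1 : θ 0 = 1) (t : Strategy L I J J) :
    dualGuarantee G x Q ζ θ t = oneStageMax G x Q ζ (firstAction t) := by
  refine eq_of_forall_ge_iff fun c => ?_
  rw [dualGuarantee_le_iff, oneStageMax, ciSup_le_iff (Set.finite_range _).bddAbove]
  simp only [bestPayoff_le_iff G Q ζ hθ, h1, sub_self, zero_mul, add_zero, one_mul,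
    sub_le_iff_le_add', Prod.forall]
  exact forall_comm

theorem isLeast_oneStageMax [Nonempty K] [Nonempty I] [Nonempty J] (hθ : IsEvaluation θ)
    (h1 : θ 0 = 1) : IsLeast (Set.range (oneStageMax G x Q ζ)) (dualMinmax G x Q ζ θ) := by
  have hs := hθ.2.summable
  constructor
  · obtain ⟨t, ht⟩ := exists_dualGuarantee_eq (I := I) (J := J) G x Q ζ hs
    exact ⟨firstAction t, by rw [← ht, dualGuarantee_eq_oneStageMax G x Q ζ hθ h1]⟩
  · rintro _ ⟨τ, rfl⟩
    have := dualMinmax_le G x Q ζ hs (fun l (_ : List (Outcome I J)) => τ l)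
    rwa [dualGuarantee_eq_oneStageMax G x Q ζ hθ h1] at this

end Dual

/-! ### Markovian strategies -/

section Policies

variable {K L I J : Type*} [Fintype L] [Fintype J]

theorem firstAction_strategy (P : Policy K L I J) (a : State K L) :
    firstAction (P.strategy a) = (P a).1 := by
  funext l
  simp [firstAction, Policy.strategy]

theorem continuation_strategy (P : Policy K L I J) (a : State K L) (i : I) (j : J) :
    continuation (P.strategy a) i j = P.strategy (P.next a i j) := by
  funext l h
  simp [continuation, Policy.strategy]

end Policies

section Markov

variable {K L I J : Type*} [Fintype K] [Fintype L] [Fintype I] [Fintype J]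
variable [Nonempty K] [Nonempty I] [Nonempty J] (G : K → L → I → J → ℝ)

theorem exists_isOptimal : ∃ P : Policy K L I J, P.IsOptimal G := by
  have h : ∀ a : State K L, ∃ c : (L → stdSimplex ℝ J) × (I → J → K → ℝ), IsEvaluation a.θ →
      (a.θ 0 < 1 → c.2 ∈ splittings G a.x a.Q a.ζ a.θ c.1 ∧
        ∀ τ, ∀ y ∈ splittings G a.x a.Q a.ζ a.θ τ,
          continuationMax G a.Q a.ζ a.θ c.1 c.2 ≤ continuationMax G a.Q a.ζ a.θ τ y) ∧
      (a.θ 0 = 1 → ∀ τ, oneStageMax G a.x a.Q a.ζ c.1 ≤ oneStageMax G a.x a.Q a.ζ τ) := by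
    intro a
    by_cases hθ : IsEvaluation a.θ
    · rcases hθ.apply_zero_le_one.lt_or_eq with h1 | h1
      · obtain ⟨inner, _, hin, ⟨⟨τ, rfl⟩, hout⟩, -⟩ :=
          exists_isLeast_continuationMax G a.x a.Q a.ζ hθ h1
        obtain ⟨y, hy, hτ⟩ := (hin τ).1
        refine ⟨(τ, y), fun _ => ⟨fun _ => ⟨hy, fun τ' y' hy' => ?_⟩, fun h2 => absurd h2 h1.ne⟩⟩
        exact hτ.le.trans ((hout ⟨τ', rfl⟩).trans ((hin τ').2 ⟨y', hy', rfl⟩))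
      · obtain ⟨⟨τ, hτ⟩, hmin⟩ := isLeast_oneStageMax G a.x a.Q a.ζ hθ h1
        exact ⟨(τ, 0), fun _ => ⟨fun h2 => absurd h1 h2.ne,
          fun _ τ' => hτ.le.trans (hmin ⟨τ', rfl⟩)⟩⟩
    · exact ⟨Classical.arbitrary _, fun h => absurd h hθ⟩
  choose P hP using h
  exact ⟨P, hP⟩

/-- The recursive formula, used at the first `n` stages, shows that what a Markovian strategy loses
with respect to the value comes from the later stages only. The loss at the type `k` is measured by
the weight `|ζ k|`, because the sum over `j` of the updated weights is again `|ζ k|`. -/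
theorem bestPayoff_strategy_le_add_tail {P : Policy K L I J} (hP : P.IsOptimal G) {C : ℝ}
    (hG : ∀ k l i j, |G k l i j| ≤ C) (n : ℕ) (a : State K L) (hθ : IsEvaluation a.θ) (k : K) :
    bestPayoff G a.Q a.ζ a.θ k (P.strategy a) ≤ a.x k + (dualMinmax G a.x a.Q a.ζ a.θ +
      2 * C * |a.ζ k| * (1 - ∑ m ∈ Finset.range n, a.θ m)) := by
  have hle : ∀ t, dualGuarantee G a.x a.Q a.ζ a.θ t = dualMinmax G a.x a.Q a.ζ a.θ →
      bestPayoff G a.Q a.ζ a.θ k t ≤ a.x k + dualMinmax G a.x a.Q a.ζ a.θ := fun t ht =>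
    (dualGuarantee_le_iff G a.x a.Q a.ζ t _).1 ht.le k
  have hs := hθ.2.summable
  induction n generalizing a with
  | zero =>
    -- both the strategy and an optimal one give payoffs in `[-C |ζ k|, C |ζ k|]` to the type `k`
    obtain ⟨t, ht⟩ := exists_dualGuarantee_eq (I := I) (J := J) G a.x a.Q a.ζ hs
    obtain ⟨f, hf⟩ := exists_typePayoff_eq_bestPayoff G a.Q a.ζ hs k t
    obtain ⟨f', hf'⟩ := exists_typePayoff_eq_bestPayoff G a.Q a.ζ hs k (P.strategy a)
    have h1 := neg_le_of_abs_le (abs_typePayoff_le G a.Q a.ζ hG hθ k f t)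
    have h2 := le_of_abs_le (abs_typePayoff_le G a.Q a.ζ hG hθ k f' (P.strategy a))
    have h3 := hle t ht
    rw [Finset.sum_range_zero]
    linarith
  | succ n ih =>
    rcases hθ.apply_zero_le_one.lt_or_eq with h1 | h1
    · have h2 : 0 < 1 - a.θ 0 := by linarith
      obtain ⟨hy, hmin⟩ := (hP a hθ).1 h1
      have hopt : (1 - a.θ 0) * continuationMax G a.Q a.ζ a.θ (P a).1 (P a).2 ≤
          dualMinmax G a.x a.Q a.ζ a.θ := by
        obtain ⟨t, ht⟩ := exists_dualGuarantee_eq (I := I) (J := J) G a.x a.Q a.ζ hs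
        obtain ⟨y', hy', hle'⟩ := exists_continuationMax_le G a.x a.Q a.ζ hθ h1 t
        exact (mul_le_mul_of_nonneg_left (hmin _ y' hy') h2.le).trans (hle'.trans ht.le)
      rw [← firstAction_strategy P a] at hy
      refine bestPayoff_le_of_continuation G a.Q a.ζ a.x hθ h1 hy (W := fun i j =>
        dualMinmax G ((P a).2 i j) (updateQ a.Q (P a).1 j) (updateWeight a.Q a.ζ (P a).1 j)
          (shift a.θ) + 2 * C * |updateWeight a.Q a.ζ (P a).1 j k| *
          (1 - ∑ m ∈ Finset.range n, shift a.θ m)) (fun i j => ?_) fun i => ?_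
      · rw [firstAction_strategy, continuation_strategy]
        exact ih (P.next a i j) (hθ.shift h1)
          (fun t ht => (dualGuarantee_le_iff _ _ _ _ _ _).1 ht.le k) (hθ.shift h1).2.summable
      · rw [Finset.sum_add_distrib, ← Finset.sum_mul, ← Finset.mul_sum, sum_abs_updateWeight]
        have h3 := mul_le_mul_of_nonneg_left
          ((continuationMax_le_iff G a.Q a.ζ a.θ (P a).1 (P a).2 _).1 le_rfl i) h2.le
        have h4 : (1 - a.θ 0) * (1 - ∑ m ∈ Finset.range n, shift a.θ m) =
            1 - ∑ m ∈ Finset.range (n + 1), a.θ m := by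
          rw [mul_sub, Finset.mul_sum, Finset.sum_range_succ']
          simp only [hθ.mul_shift]
          ring
        rw [← h4]
        linarith
    · have hopt : dualGuarantee G a.x a.Q a.ζ a.θ (P.strategy a) ≤
          dualMinmax G a.x a.Q a.ζ a.θ := by
        rw [dualGuarantee_eq_oneStageMax G a.x a.Q a.ζ hθ h1, firstAction_strategy]
        obtain ⟨τ, hτ⟩ := (isLeast_oneStageMax G a.x a.Q a.ζ hθ h1).1
        exact hτ ▸ (hP a hθ).2 h1 τ
      have h2 := (dualGuarantee_le_iff G a.x a.Q a.ζ _ _).1 hopt k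
      have h3 : ∑ m ∈ Finset.range (n + 1), a.θ m ≤ 1 :=
        sum_le_hasSum _ (fun m _ => hθ.1 m) hθ.2
      obtain ⟨f, -⟩ := exists_typePayoff_eq_bestPayoff G a.Q a.ζ hs k (P.strategy a)
      have h4 := (abs_nonneg _).trans (abs_typePayoff_le G a.Q a.ζ hG hθ k f (P.strategy a))
      have := mul_nonneg h4 (sub_nonneg.2 h3)
      linarith

/-- Markovian strategies given by optimal policies are optimal in the dual game. -/
theorem dualGuarantee_strategy_le {P : Policy K L I J} (hP : P.IsOptimal G) (a : State K L)
    (hθ : IsEvaluation a.θ) :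
    dualGuarantee G a.x a.Q a.ζ a.θ (P.strategy a) ≤ dualMinmax G a.x a.Q a.ζ a.θ := by
  obtain ⟨C, hC⟩ := (Set.finite_range fun z : K × L × I × J =>
    |G z.1 z.2.1 z.2.2.1 z.2.2.2|).bddAbove
  rw [dualGuarantee_le_iff]
  intro k
  have htail : Filter.Tendsto (fun n => a.x k + (dualMinmax G a.x a.Q a.ζ a.θ +
      2 * C * |a.ζ k| * (1 - ∑ m ∈ Finset.range n, a.θ m))) Filter.atTop
      (nhds (a.x k + (dualMinmax G a.x a.Q a.ζ a.θ + 2 * C * |a.ζ k| * (1 - 1)))) :=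
    (((hθ.2.tendsto_sum_nat.const_sub 1).const_mul _).const_add _).const_add _
  have := ge_of_tendsto' htail fun n => bestPayoff_strategy_le_add_tail G hP
    (fun k l i j => hC ⟨(k, l, i, j), rfl⟩) n a hθ k
  simpa using this

end Markov

/-! ### From the dual game to the primal game -/

section Primal

variable {K L I J : Type*} [Fintype K] [Fintype L] [Fintype I] [Fintype J]
variable (G : K → L → I → J → ℝ) (Q : K → stdSimplex ℝ L) (ζ : K → ℝ) {θ : ℕ → ℝ}

theorem payoff_le_sum_bestPayoff (hθ : Summable θ) (p : stdSimplex ℝ K) (s : Strategy K I J I)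
    (t : Strategy L I J J) :
    payoff G (prodCond p Q) ζ θ s t ≤ ∑ k, p k * bestPayoff G Q ζ θ k t := by
  rw [payoff_prodCond G Q ζ p hθ]
  exact Finset.sum_le_sum fun k _ => mul_le_mul_of_nonneg_left
    (typePayoff_le_bestPayoff G Q ζ hθ k (s k) t) (stdSimplex.zero_le p k)

variable [Nonempty I]

theorem iSup_payoff (hθ : Summable θ) (p : stdSimplex ℝ K) (t : Strategy L I J J) :
    ⨆ s : Strategy K I J I, payoff G (prodCond p Q) ζ θ s t =
      ∑ k, p k * bestPayoff G Q ζ θ k t := by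
  refine le_antisymm (ciSup_le fun s => payoff_le_sum_bestPayoff G Q ζ hθ p s t) ?_
  choose s hs using fun k => exists_typePayoff_eq_bestPayoff G Q ζ hθ k t
  refine le_trans (le_of_eq ?_) (le_ciSup ⟨_, by
    rintro _ ⟨s, rfl⟩; exact payoff_le_sum_bestPayoff G Q ζ hθ p s t⟩ s)
  simp only [payoff_prodCond G Q ζ p hθ, hs]

variable [Nonempty J]

/-- An optimal strategy of player 2 in the primal game. -/
theorem exists_forall_sum_bestPayoff_le (hθ : Summable θ) (p : stdSimplex ℝ K) :
    ∃ t : Strategy L I J J, ∀ t' : Strategy L I J J,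
      ∑ k, p k * bestPayoff G Q ζ θ k t ≤ ∑ k, p k * bestPayoff G Q ζ θ k t' := by
  have hlsc : LowerSemicontinuous fun t : Strategy L I J J =>
      ∑ k, p k * bestPayoff G Q ζ θ k t := by
    simp only [← iSup_payoff G Q ζ hθ p]
    refine lowerSemicontinuous_ciSup (fun t => ⟨_, by
      rintro _ ⟨s, rfl⟩; exact payoff_le_sum_bestPayoff G Q ζ hθ p s t⟩) fun s => ?_
    exact (continuous_payoff G Q ζ hθ continuous_const continuous_const
      continuous_id).lowerSemicontinuous
  obtain ⟨t, -, ht⟩ := (hlsc.lowerSemicontinuousOn Set.univ).exists_isMinOn Set.univ_nonempty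
    isCompact_univ
  exact ⟨t, fun t' => ht (Set.mem_univ t')⟩

theorem primalMinmax_le (hθ : Summable θ) (p : stdSimplex ℝ K) (t : Strategy L I J J) :
    primalMinmax G (prodCond p Q) ζ θ ≤ ∑ k, p k * bestPayoff G Q ζ θ k t := by
  obtain ⟨t₀, ht₀⟩ := exists_forall_sum_bestPayoff_le (I := I) (J := J) G Q ζ hθ p
  simp only [primalMinmax, iSup_payoff G Q ζ hθ]
  exact ciInf_le ⟨_, by rintro _ ⟨t', rfl⟩; exact ht₀ t'⟩ t

/-- The vector of the best payoffs against an optimal strategy of player 2 is a supergradient of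
the value. -/
theorem exists_isSupergradient (hθ : Summable θ) (p : stdSimplex ℝ K) :
    ∃ x : K → ℝ, IsSupergradient (fun p' => primalMinmax G (prodCond p' Q) ζ θ) p x := by
  obtain ⟨t, ht⟩ := exists_forall_sum_bestPayoff_le (I := I) (J := J) G Q ζ hθ p
  refine ⟨fun k => bestPayoff G Q ζ θ k t, fun p' => ?_⟩
  have h1 := primalMinmax_le G Q ζ hθ p' t
  have h2 : ∑ k, p k * bestPayoff G Q ζ θ k t ≤ primalMinmax G (prodCond p Q) ζ θ := by
    simp only [primalMinmax, iSup_payoff G Q ζ hθ]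
    exact le_ciInf ht
  simp only [mul_sub, Finset.sum_sub_distrib]
  simp only [mul_comm (bestPayoff _ _ _ _ _ _)]
  linarith

/-- The inequality of conjugacy: the dual value is at most the supremum over `p` of the primal value
minus `⟨p, x⟩`. This uses the existence of the values of both games. -/
theorem dualMinmax_le_of_forall [Nonempty K] (hθ : Summable θ) (x : K → ℝ) {c : ℝ}
    (h : ∀ p : stdSimplex ℝ K, primalMinmax G (prodCond p Q) ζ θ - ∑ k, p k * x k ≤ c) :
    dualMinmax G x Q ζ θ ≤ c := by
  rw [← dualMaxmin_eq G Q ζ x hθ]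
  refine ciSup_le fun ps => le_trans ?_ (h ps.1)
  have hcont : Continuous fun st : Strategy K I J I × Strategy L I J J =>
      payoff G (prodCond ps.1 Q) ζ θ st.1 st.2 :=
    continuous_payoff G Q ζ hθ continuous_const continuous_fst continuous_snd
  obtain ⟨M, hM⟩ := (isCompact_range hcont).bddAbove
  obtain ⟨m, hm⟩ := (isCompact_range hcont).bddBelow
  have hbelow : ∀ s, BddBelow (Set.range fun t => payoff G (prodCond ps.1 Q) ζ θ s t) :=
    fun s => ⟨m, by rintro _ ⟨t, rfl⟩; exact hm ⟨(s, t), rfl⟩⟩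
  rw [← primalMaxmin_prodCond_eq G Q ζ ps.1 hθ, le_sub_iff_add_le]
  have h1 : ⨅ t, payoff G (prodCond ps.1 Q) ζ θ ps.2 t ≤ primalMaxmin G (prodCond ps.1 Q) ζ θ := by
    refine le_ciSup (f := fun s => ⨅ t, payoff G (prodCond ps.1 Q) ζ θ s t) ⟨M, ?_⟩ ps.2
    rintro _ ⟨s, rfl⟩
    exact (ciInf_le (hbelow s) (Classical.arbitrary _)).trans (hM ⟨(s, _), rfl⟩)
  refine le_trans (le_ciInf fun t => ?_) h1
  rw [← le_sub_iff_add_le]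
  refine ciInf_le (f := fun t => dualPayoff G x Q ζ θ ps.1 ps.2 t)
    ⟨m - ∑ k, ps.1 k * x k, ?_⟩ t
  rintro _ ⟨t, rfl⟩
  exact sub_le_sub_right (hm ⟨(ps.2, t), rfl⟩) _

/-- A strategy that is optimal in the dual game at a supergradient of the primal value is optimal
in the primal game. -/
theorem payoff_le_of_dualGuarantee_le [Nonempty K] (hθ : Summable θ) {p : stdSimplex ℝ K}
    {x : K → ℝ} (hx : IsSupergradient (fun p' => primalMinmax G (prodCond p' Q) ζ θ) p x)
    {t : Strategy L I J J} (ht : dualGuarantee G x Q ζ θ t ≤ dualMinmax G x Q ζ θ)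
    (s : Strategy K I J I) :
    payoff G (prodCond p Q) ζ θ s t ≤ primalMinmax G (prodCond p Q) ζ θ := by
  have h1 : dualMinmax G x Q ζ θ ≤ primalMinmax G (prodCond p Q) ζ θ - ∑ k, p k * x k := by
    refine dualMinmax_le_of_forall G Q ζ hθ x fun p' => ?_
    have := hx p'
    simp only [mul_comm (x _), sub_mul, Finset.sum_sub_distrib] at this
    linarith
  have h2 := dualPayoff_le_dualGuarantee G x Q ζ hθ p s t
  rw [dualPayoff] at h2
  linarith

end Primal

end RepeatedGame

end

open RepeatedGame in
theorem mainTheorem1 {K L I J : Type*} [Fintype K] [Fintype L] [Fintype I] [Fintype J]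
    [Nonempty K] [Nonempty L] [Nonempty I] [Nonempty J] (G : K → L → I → J → ℝ) :
    -- the games have values
    (∀ (π : stdSimplex ℝ (K × L)) (ζ : K → ℝ) (θ : ℕ → ℝ), IsEvaluation θ →
      primalMaxmin G π ζ θ = primalMinmax G π ζ θ) ∧
    (∀ (x : K → ℝ) (Q : K → stdSimplex ℝ L) (ζ : K → ℝ) (θ : ℕ → ℝ), IsEvaluation θ →
      dualMaxmin G x Q ζ θ = dualMinmax G x Q ζ θ) ∧
    -- the recursive formula, in which both minima are attained
    (∀ (x : K → ℝ) (Q : K → stdSimplex ℝ L) (ζ : K → ℝ) (θ : ℕ → ℝ), IsEvaluation θ → θ 0 < 1 →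
      ∃ (inner : (L → stdSimplex ℝ J) → ℝ) (outer : ℝ),
        (∀ τ, IsLeast (continuationMax G Q ζ θ τ '' splittings G x Q ζ θ τ) (inner τ)) ∧
        IsLeast (Set.range inner) outer ∧
        dualMinmax G x Q ζ θ = (1 - θ 0) * outer) ∧
    -- its form when the first stage carries the whole weight
    (∀ (x : K → ℝ) (Q : K → stdSimplex ℝ L) (ζ : K → ℝ) (θ : ℕ → ℝ), IsEvaluation θ → θ 0 = 1 →
      IsLeast (Set.range (oneStageMax G x Q ζ)) (dualMinmax G x Q ζ θ)) ∧
    -- minimizers can be selected, and every selection gives an optimal strategy in the dual game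
    (∃ P : Policy K L I J, P.IsOptimal G) ∧
    (∀ P : Policy K L I J, P.IsOptimal G →
      ∀ (x : K → ℝ) (Q : K → stdSimplex ℝ L) (ζ : K → ℝ) (θ : ℕ → ℝ), IsEvaluation θ →
        IsOptimalDual G x Q ζ θ (P.strategy ⟨x, Q, ζ, θ⟩)) ∧
    -- Markovian optimal strategies in the repeated game, for an arbitrary prior
    (∀ π : stdSimplex ℝ (K × L), ∃ (p : stdSimplex ℝ K) (Q : K → stdSimplex ℝ L),
      π = prodCond p Q) ∧
    (∀ (p : stdSimplex ℝ K) (Q : K → stdSimplex ℝ L) (θ : ℕ → ℝ), IsEvaluation θ →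
      (∃ x : K → ℝ, IsSupergradient (fun p' => primalMinmax G (prodCond p' Q) 1 θ) p x) ∧
      ∀ x : K → ℝ, IsSupergradient (fun p' => primalMinmax G (prodCond p' Q) 1 θ) p x →
        ∀ P : Policy K L I J, P.IsOptimal G →
          IsOptimalPrimal G (prodCond p Q) θ (P.strategy ⟨x, Q, 1, θ⟩)) := by
  refine ⟨fun π ζ θ hθ => ?_, fun x Q ζ θ hθ => dualMaxmin_eq G Q ζ x hθ.2.summable,
    fun x Q ζ θ hθ h1 => exists_isLeast_continuationMax G x Q ζ hθ h1,
    fun x Q ζ θ hθ h1 => isLeast_oneStageMax G x Q ζ hθ h1, exists_isOptimal G,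
    fun P hP x Q ζ θ hθ p s => ?_, exists_eq_prodCond, fun p Q θ hθ =>
    ⟨exists_isSupergradient G Q 1 hθ.2.summable p, fun x hx P hP s => ?_⟩⟩
  · obtain ⟨p, Q, rfl⟩ := exists_eq_prodCond π
    exact primalMaxmin_prodCond_eq G Q ζ p hθ.2.summable
  · exact (dualPayoff_le_dualGuarantee G x Q ζ hθ.2.summable p s _).trans
      (dualGuarantee_strategy_le G hP ⟨x, Q, ζ, θ⟩ hθ)
  · exact payoff_le_of_dualGuarantee_le G Q 1 hθ.2.summable hx
      (dualGuarantee_strategy_le G hP ⟨x, Q, 1, θ⟩ hθ) s
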